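/- Let $d\ge 0$, $T\ge 0$, $a_0,a_1,\sigma,r\in\mathbb R$, $b_0\ge 0$, $b_1\in L^2([-d,0];\mathbb R^+)$, $\delta\in L^2([-d,0];\mathbb R)$. Let $W$ be a real Brownian motion on a complete probability space $(\Omega,\mathcal F,\mathbb P)$, let $\mathbb F$ be the augmentation of the filtration generated by $W$, and let $\mathcal U=L^2_{\mathcal P}(\Omega\times[0,T];\mathbb R)$ be the set of square-integrable progressively measurable processes. For $t\in[0,T]$, $x\in\mathbb R$, $u\in\mathcal U$, let $X=X^{t,x,u}$ be the unique (up to indistinguishability) continuous solution in $L^2_{\mathcal P}(\Omega\times[t,T];\mathbb R)$ of $$dX(s)=\Big[a_0X(s)+a_1\mathbb E[X(s)]+b_0u(s)+\int_{-d}^0 b_1(\xi)u(s+\xi)\,d\xi\Big]ds+\sigma\,dW(s),\quad s\in[t,T],$$ with $X(t)=x$ and $u(t+\xi)=\delta(\xi)$ for $\xi\in[-d,0]$. Let $$J(t,x;u)=\mathbb E\Big[\int_t^T e^{-r(s-t)}f\big(s,X(s),\mathbb E[X(s)],u(s),\mathbb E[u(s)]\big)ds+e^{-r(T-t)}g\big(X(T),\mathbb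 E[X(T)]\big)\Big],\qquad \overline V(t,x)=\sup_{u\in\mathcal U}J(t,x;u),$$ where, for real $\alpha_0,\alpha_1,\beta_0,\beta_1,\lambda_0,\lambda_1$ and $\gamma_0,\gamma_1>0$, $$f(t,x,m,u,z)=\alpha_0x-\alpha_1m-\beta_0u-\gamma_0u^2-\beta_1z-\gamma_1z^2,\qquad g(x,m)=\lambda_0x-\lambda_1m .$$ Put $\tilde\alpha=(\alpha_0,-\alpha_1)$, $\tilde\beta=(\beta_0,\beta_1)$, $\tilde\lambda=(\lambda_0,-\lambda_1)$, $A_0=\begin{bmatrix}a_0&a_1\\0&a_0+a_1\end{bmatrix}$, and let $H=\mathbb R^2\times L^2([-d,0];\mathbb R^2)$. Define $B:\mathbb R^2\to H$ by $Bv=(b_0v,b_1(\cdot)v)$, with adjoint $B^*$, and let $(e^{\tau A^*})_{\tau\ge0}$ be the $C_0$-semigroup on $H$ $$e^{\tau A^*}y=\big(e^{\tau A_0^*}y_0,\ e^{(\cdot+\tau)A_0^*}y_0\mathbf 1_{[-\tau,0]}(\cdot)+y_1(\cdot+\tau)\mathbf 1_{[-d,-\tau]}(\cdot)\big).$$ For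 $s\in[0,T]$ let $$a(s)=e^{-r(T-s)}e^{(T-s)A^*}(\tilde\lambda,0)+\int_s^T e^{-r(\rho-s)}e^{(\rho-s)A^*}(\tilde\alpha,0)\,d\rho ,$$ and for $q\in\mathbb R^2$ let $$u^*(q)=\operatorname*{arg\,max}_{u\in\mathbb R}\big\{\langle\tilde\alpha,(x,x)\rangle+\langle q-\tilde\beta,(1,1)\rangle u-(\gamma_0+\gamma_1)u^2\big\}.$$ Then, for all $t\in[0,T]$ and $x\in\mathbb R$: the maximiser is $u^*(q)=\dfrac{\langle q-\tilde\beta,(1,1)\rangle}{2(\gamma_0+\gamma_1)}$; the state equation has, for every $u\in\mathcal U$, a unique solution as above; and the deterministic control $s\mapsto u^*(B^*a(s))$ belongs to $\mathcal U$ and is optimal for $\overline V(t,x)$, that is, $\overline V(t,x)=J\big(t,x;u^*(B^*a(\cdot))\big)$. -/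

import Mathlib

open MeasureTheory ProbabilityTheory Set
open scoped NNReal ENNReal InnerProductSpace

noncomputable section

namespace Advertising

/-! ### The model -/

/-- Coefficients and initial data of the goodwill dynamics: the delay `d`, the horizon `T`, the
coefficients `a0, a1, b0, b1, σ`, the past advertising expenditure `δ` on `[-d, 0]` and the discount
rate `r`. The control set is `U = ℝ`. -/
structure Model where
  d : ℝ
  T : ℝ
  a0 : ℝ
  a1 : ℝ
  b0 : ℝ
  b1 : ℝ → ℝ
  σ : ℝ
  δ : ℝ → ℝ
  r : ℝ
  d_nonneg : 0 ≤ d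
  b0_nonneg : 0 ≤ b0
  b1_memLp : MemLp b1 2 (volume.restrict (Icc (-d) 0))
  b1_nonneg : ∀ᵐ ξ ∂(volume.restrict (Icc (-d) 0)), 0 ≤ b1 ξ
  δ_memLp : MemLp δ 2 (volume.restrict (Icc (-d) 0))

/-- Coefficients of the linear-quadratic objective. -/
structure LQ where
  α0 : ℝ
  α1 : ℝ
  β0 : ℝ
  β1 : ℝ
  γ0 : ℝ
  γ1 : ℝ
  lam0 : ℝ
  lam1 : ℝ
  γ0_pos : 0 < γ0
  γ1_pos : 0 < γ1

/-- The running objective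
`f(t,x,m,u,z) = α₀ x - α₁ m - β₀ u - γ₀ u² - β₁ z - γ₁ z²`. -/
def LQ.f (Q : LQ) (_t x m u z : ℝ) : ℝ :=
  Q.α0 * x - Q.α1 * m - Q.β0 * u - Q.γ0 * u ^ 2 - Q.β1 * z - Q.γ1 * z ^ 2

/-- The terminal objective `g(x,m) = λ₀ x - λ₁ m`. -/
def LQ.g (Q : LQ) (x m : ℝ) : ℝ := Q.lam0 * x - Q.lam1 * m

/-! ### The stochastic setting -/

section Stochastic

variable {Ω : Type*} {mΩ : MeasurableSpace Ω}

/-- The augmentation of the filtration generated by a Brownian motion `W`: the σ-algebra at time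
`i` is generated by the `W j`, `j ≤ i`, and by all the `P`-null sets. -/
def augFiltration (W : ℝ≥0 → Ω → ℝ) (P : Measure Ω) [P.IsComplete]
    (hW : IsBrownianReal W P) : Filtration ℝ≥0 mΩ where
  seq i := (⨆ j ≤ i, MeasurableSpace.comap (W j) inferInstance) ⊔
    MeasurableSpace.generateFrom {N : Set Ω | P N = 0}
  mono' _ _ hij := sup_le_sup_right (biSup_mono fun _ hj => le_trans hj hij) _
  le' i := by
    refine sup_le (iSup₂_le fun j _ => ?_) (MeasurableSpace.generateFrom_le fun N hN => ?_)
    · exact ((hW.toIsPreBrownianReal.aemeasurable j).nullMeasurable.measurable_of_complete).comap_le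
    · exact Measure.IsComplete.out' N hN

/-- Progressive measurability on the time interval `[a, b]` (for `0 ≤ a`): for every
`s ∈ [a, b]` the restriction of the process to `[a, s] × Ω` is measurable with respect to the
product of the Borel σ-algebra and the σ-algebra at time `s`. -/
def ProgressiveOn (ℱ : Filtration ℝ≥0 mΩ) (a b : ℝ) (u : ℝ → Ω → ℝ) : Prop :=
  ∀ s ∈ Icc a b,
    Measurable[Subtype.instMeasurableSpace.prod (ℱ s.toNNReal)]
      fun p : Icc a s × Ω => u p.1 p.2

/-- Membership in `L²_𝒫(Ω × [a, b]; ℝ)`: progressively measurable and square integrable. -/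
structure MemL2Prog (P : Measure Ω) (ℱ : Filtration ℝ≥0 mΩ) (a b : ℝ) (u : ℝ → Ω → ℝ) :
    Prop where
  progressive : ProgressiveOn ℱ a b u
  memLp : MemLp (Function.uncurry u) 2 ((volume.restrict (Icc a b)).prod P)

/-- The set `𝒰` of admissible controls. -/
def Model.controls (M : Model) (P : Measure Ω) (ℱ : Filtration ℝ≥0 mΩ) : Set (ℝ → Ω → ℝ) :=
  {u | MemL2Prog P ℱ 0 M.T u}

/-- The control `u`, started at time `t` and extended to the past by `u(t + ξ) = δ(ξ)`,
`ξ ∈ [-d, 0]`. -/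
def Model.extend (M : Model) (t : ℝ) (u : ℝ → Ω → ℝ) (s : ℝ) (ω : Ω) : ℝ :=
  if s ≤ t then M.δ (s - t) else u s ω

/-- The drift
`a₀ X(s) + a₁ 𝔼[X(s)] + b₀ u(s) + ∫_{-d}^0 b₁(ξ) u(s+ξ) dξ`. -/
def Model.drift (M : Model) (P : Measure Ω) (t : ℝ) (u X : ℝ → Ω → ℝ) (s : ℝ) (ω : Ω) : ℝ :=
  M.a0 * X s ω + M.a1 * (∫ ω', X s ω' ∂P) + M.b0 * M.extend t u s ω +
    ∫ ξ in (-M.d)..0, M.b1 ξ * M.extend t u (s + ξ) ω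

/-- `X` is a strong solution, with continuous paths, on `[t, T]` of the controlled McKean–Vlasov
delay equation
`dX(s) = [a₀ X(s) + a₁ 𝔼[X(s)] + b₀ u(s) + ∫_{-d}^0 b₁(ξ) u(s+ξ) dξ] ds + σ dW(s)`, `X(t) = x`,
`u(t+ξ) = δ(ξ)` for `ξ ∈ [-d,0]`. Since `σ` is constant the stochastic integral over `[t, s]` is
`σ (W(s) - W(t))`. -/
structure Model.IsSolution (M : Model) (P : Measure Ω) (ℱ : Filtration ℝ≥0 mΩ)
    (W : ℝ≥0 → Ω → ℝ) (t x : ℝ) (u X : ℝ → Ω → ℝ) : Prop where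
  memL2 : MemL2Prog P ℱ t M.T X
  continuous_paths : ∀ᵐ ω ∂P, ContinuousOn (fun s => X s ω) (Icc t M.T)
  equation : ∀ᵐ ω ∂P, ∀ s ∈ Icc t M.T,
    X s ω = x + (∫ τ in t..s, M.drift P t u X τ ω) +
      M.σ * (W s.toNNReal ω - W t.toNNReal ω)

open Classical in
/-- The state process `X^{t,x,u}`: the solution of the state equation (and `0` if there were
none). -/
def Model.state (M : Model) (P : Measure Ω) (ℱ : Filtration ℝ≥0 mΩ)
    (W : ℝ≥0 → Ω → ℝ) (t x : ℝ) (u : ℝ → Ω → ℝ) : ℝ → Ω → ℝ :=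
  if h : ∃ X, M.IsSolution P ℱ W t x u X then h.choose else 0

/-- The objective functional
`J(t,x;u) = 𝔼[∫_t^T e^{-r(s-t)} f(s, X(s), 𝔼[X(s)], u(s), 𝔼[u(s)]) ds
  + e^{-r(T-t)} 𝔼[g(X(T), 𝔼[X(T)])]]`, `X = X^{t,x,u}`. -/
def Model.J (M : Model) (f : ℝ → ℝ → ℝ → ℝ → ℝ → ℝ) (g : ℝ → ℝ → ℝ)
    (P : Measure Ω) (ℱ : Filtration ℝ≥0 mΩ)
    (W : ℝ≥0 → Ω → ℝ) (t x : ℝ) (u : ℝ → Ω → ℝ) : ℝ :=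
  let X := M.state P ℱ W t x u
  ∫ ω, ((∫ s in t..M.T, Real.exp (-M.r * (s - t)) *
      f s (X s ω) (∫ ω', X s ω' ∂P) (u s ω) (∫ ω', u s ω' ∂P)) +
    Real.exp (-M.r * (M.T - t)) * ∫ ω', g (X M.T ω') (∫ ω'', X M.T ω'' ∂P) ∂P) ∂P

/-- The value function `V̄(t,x) = sup_{u ∈ 𝒰} J(t,x;u)`. The supremum is taken in the extended
reals, so that no boundedness is presupposed. -/
def Model.value (M : Model) (f : ℝ → ℝ → ℝ → ℝ → ℝ → ℝ) (g : ℝ → ℝ → ℝ)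
    (P : Measure Ω) (ℱ : Filtration ℝ≥0 mΩ) (W : ℝ≥0 → Ω → ℝ) (t x : ℝ) : EReal :=
  ⨆ u ∈ M.controls P ℱ, (M.J f g P ℱ W t x u : EReal)

/-- `u` is an optimal control strategy for `V̄(t,x)`. -/
def Model.IsOptimal (M : Model) (f : ℝ → ℝ → ℝ → ℝ → ℝ → ℝ) (g : ℝ → ℝ → ℝ)
    (P : Measure Ω) (ℱ : Filtration ℝ≥0 mΩ) (W : ℝ≥0 → Ω → ℝ) (t x : ℝ)
    (u : ℝ → Ω → ℝ) : Prop :=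
  u ∈ M.controls P ℱ ∧ M.value f g P ℱ W t x = (M.J f g P ℱ W t x u : EReal)

end Stochastic

/-! ### The Hilbert space and its operators -/

/-- The plane `ℝ²` with the Euclidean structure. -/
abbrev E2 : Type := EuclideanSpace ℝ (Fin 2)

/-- Lebesgue measure on `[-d, 0]`. -/
abbrev Model.hist (M : Model) : Measure ℝ := volume.restrict (Icc (-M.d) 0)

/-- The Hilbert space `H = ℝ² × L²([-d,0]; ℝ²)`. -/
abbrev Model.H (M : Model) : Type := WithLp 2 (E2 × Lp E2 2 M.hist)

/-- The operator on `ℝ²` with matrix `A₀ = [[a₀, a₁], [0, a₀ + a₁]]`. -/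
def Model.A0 (M : Model) : E2 →L[ℝ] E2 :=
  Matrix.toEuclideanCLM (n := Fin 2) (𝕜 := ℝ) !![M.a0, M.a1; 0, M.a0 + M.a1]

/-- `e^{τ A₀*}`. -/
def Model.expA0star (M : Model) (τ : ℝ) : E2 →L[ℝ] E2 :=
  NormedSpace.exp (τ • ContinuousLinearMap.adjoint M.A0)

/-- The history component of `e^{τ A*} y`: at `ξ ∈ [-d, 0]` it equals `e^{(ξ+τ) A₀*} y₀` if
`ξ > -τ` and `y₁(ξ + τ)` if `ξ ≤ -τ`. (The function `y₁` is extended by `0` outside `[-d, 0]`,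
which is irrelevant for `τ ≥ 0`.) -/
def Model.semigroupHist (M : Model) (τ : ℝ) (y : M.H) (ξ : ℝ) : E2 :=
  {ξ' : ℝ | -τ < ξ'}.piecewise (fun ξ' => M.expA0star (ξ' + τ) y.fst)
    (fun ξ' => (Icc (-M.d) 0).indicator (y.snd : ℝ → E2) (ξ' + τ)) ξ

lemma Model.continuous_expA0star (M : Model) : Continuous M.expA0star := by
  refine continuous_iff_continuousAt.2 fun τ => ?_
  exact (hasDerivAt_exp_smul_const (𝕂 := ℝ) (ContinuousLinearMap.adjoint M.A0) τ).continuousAt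

lemma Model.memLp_semigroupHist (M : Model) (τ : ℝ) (y : M.H) :
    MemLp (M.semigroupHist τ y) 2 M.hist := by
  refine MemLp.piecewise (measurableSet_lt measurable_const measurable_id) ?_ ?_
  · have hc : Continuous fun ξ : ℝ => M.expA0star (ξ + τ) y.fst :=
      (M.continuous_expA0star.comp (by fun_prop)).clm_apply continuous_const
    obtain ⟨C, hC⟩ := (isCompact_Icc (a := -M.d) (b := 0)).exists_bound_of_continuousOn
      hc.continuousOn
    refine MemLp.restrict _ ?_
    exact MemLp.of_bound hc.aestronglyMeasurable C
      (ae_restrict_of_forall_mem measurableSet_Icc hC)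
  · refine MemLp.restrict _ (MemLp.restrict _ ?_)
    have h := (memLp_indicator_iff_restrict (f := (y.snd : ℝ → E2)) (p := 2) (μ := volume)
      (measurableSet_Icc (a := -M.d) (b := 0))).2 (Lp.memLp y.snd)
    exact h.comp_measurePreserving (measurePreserving_add_right volume τ)

/-- The `C₀`-semigroup `e^{τ A*}`, `τ ≥ 0`, on `H`, generated by the operator
`A* y = (A₀* y₀, ẏ₁)` with domain `{y : y₁ ∈ W^{1,2}([-d,0]; ℝ²), y₁(0) = y₀}`:
`e^{τ A*} y = (e^{τ A₀*} y₀, e^{(·+τ) A₀*} y₀ 1_{[-τ,0]} + y₁(· + τ) 1_{[-d,-τ]})`. -/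
def Model.semigroup (M : Model) (τ : ℝ) (y : M.H) : M.H :=
  WithLp.toLp 2 (M.expA0star τ y.fst, (M.memLp_semigroupHist τ y).toLp _)

lemma Model.memLp_b1_smul (M : Model) (v : E2) :
    MemLp (fun ξ => M.b1 ξ • v) 2 M.hist :=
  M.b1_memLp.continuousLinearMap_comp (ContinuousLinearMap.toSpanSingleton ℝ v)

/-- The control operator `B : ℝ² → H`, `B v = (b₀ v, b₁(·) v)`. -/
def Model.B (M : Model) : E2 →L[ℝ] M.H :=
  LinearMap.toContinuousLinearMap
    { toFun := fun v => WithLp.toLp 2 (M.b0 • v, (M.memLp_b1_smul v).toLp _)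
      map_add' := fun v w => by
        refine WithLp.ofLp_injective 2 (Prod.ext (smul_add M.b0 v w) ?_)
        have h := MemLp.toLp_congr (M.memLp_b1_smul (v + w))
          ((M.memLp_b1_smul v).add (M.memLp_b1_smul w))
          (ae_of_all _ fun ξ => smul_add (M.b1 ξ) v w)
        exact h.trans (MemLp.toLp_add (M.memLp_b1_smul v) (M.memLp_b1_smul w))
      map_smul' := fun c v => by
        refine WithLp.ofLp_injective 2 (Prod.ext (smul_comm M.b0 c v) ?_)
        have h := MemLp.toLp_congr (M.memLp_b1_smul (c • v)) ((M.memLp_b1_smul v).const_smul c)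
          (ae_of_all _ fun ξ => smul_comm (M.b1 ξ) c v)
        exact h.trans (MemLp.toLp_const_smul c (M.memLp_b1_smul v)) }

/-- The adjoint `B* : H → ℝ²`. -/
def Model.Bstar (M : Model) : M.H →L[ℝ] E2 := ContinuousLinearMap.adjoint M.B

/-- `α̃ = (α₀, -α₁)`. -/
def LQ.αt (Q : LQ) : E2 := !₂[Q.α0, -Q.α1]

/-- `β̃ = (β₀, β₁)`. -/
def LQ.βt (Q : LQ) : E2 := !₂[Q.β0, Q.β1]

/-- `λ̃ = (λ₀, -λ₁)`. -/
def LQ.lamt (Q : LQ) : E2 := !₂[Q.lam0, -Q.lam1]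

/-- The function `a : [0,T] → H`,
`a(t) = e^{(T-t)(A*-r)} (λ̃, 0) + ∫_t^T e^{(s-t)(A*-r)} (α̃, 0) ds`. -/
def Model.a (M : Model) (Q : LQ) (t : ℝ) : M.H :=
  Real.exp (-M.r * (M.T - t)) • M.semigroup (M.T - t) (WithLp.toLp 2 (Q.lamt, 0)) +
    ∫ s in t..M.T, Real.exp (-M.r * (s - t)) • M.semigroup (s - t) (WithLp.toLp 2 (Q.αt, 0))

/-- The function maximised over `u ∈ ℝ` by `u*(q)`:
`⟨α̃, y₀⟩ + ⟨q - β̃, (1,1)⟩ u - (γ₀ + γ₁) u²`. -/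
def LQ.hamiltonian (Q : LQ) (y0 q : E2) (u : ℝ) : ℝ :=
  ⟪Q.αt, y0⟫_ℝ + ⟪q - Q.βt, !₂[1, 1]⟫_ℝ * u - (Q.γ0 + Q.γ1) * u ^ 2

end Advertising

end

/-!
Since `σ` is constant, the state equation is, path by path, a linear Volterra equation with a
forcing term built from the control, its delay integral and the Brownian increments. Its mean `m`
solves a deterministic Volterra equation with rate `c = a₀ + a₁`, and the centred part solves one
with rate `a₀`. Both are solved by the explicit resolvent `volterraSol`; this gives existence
(`Model.exists_isSolution`), and uniqueness follows from `eq_zero_of_volterra`, applied first to the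
means and then to the paths.

The objective is affine in the state, hence depends on the state only through `m`. Let `A` be the
scalar costate (`Model.costate`), solving `A' = -(c - r) A - (α₀ - α₁)`, `A(T) = λ₀ - λ₁`.
Integration by parts (`Model.duality`) turns the state part of the objective into the integral of
the mean forcing against `e^{-r(s-t)} A(s)`, and Fubini moves the delay from the control to the costate
(`Model.integral_dcostate_force`). Consequently (`Model.J_eq`)

  `J(t,x;u) = const + ∫_t^T e^{-r(s-t)} ((q(s) - β₀ - β₁) 𝔼[u] - γ₀ 𝔼[u²] - γ₁ 𝔼[u]²) ds`,

where `q(s) = b₀ A(s) + ∫ b₁(ξ) e^{rξ} A(s - ξ) 1_{s - ξ ≤ T} dξ` (`Model.marginal`). As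
`𝔼[u]² ≤ 𝔼[u²]`, the integrand is maximal for the deterministic control
`(q - β₀ - β₁) / (2 (γ₀ + γ₁))` (`Model.isOptimal_of_eq_marginal`).

Finally `q(s) = ⟨B* a(s), (1,1)⟩` (`Model.inner_Bstar_a`): the vector `(1,1)` is an eigenvector of
`A₀` for the eigenvalue `c`, so pairing with `B (1,1)` reduces the semigroup on `H` to scalar
exponentials. The integral defining `a(s)` converges in `H` because `τ ↦ e^{τ A*} (w, 0)` is
continuous (`Model.continuous_semigroup`), so the pairing may be taken under the integral sign.
-/

noncomputable section

namespace Advertising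

/-! ### Linear Volterra equations -/

/-- The function `s ↦ ∫_t^s e^{a(s - τ)} K(τ) dτ` solves `z' = a z + K`. The exponential is
factored as `e^{as} e^{-aτ}`, so that the integrand does not depend on the upper limit. -/
lemma hasDerivAt_integral_exp_kernel {K : ℝ → ℝ} (hK : Continuous K) (a t s : ℝ) :
    HasDerivAt (fun s => Real.exp (a * s) * ∫ τ in t..s, Real.exp (-a * τ) * K τ)
      (a * (Real.exp (a * s) * ∫ τ in t..s, Real.exp (-a * τ) * K τ) + K s) s := by
  have h1 : HasDerivAt (fun s => Real.exp (a * s)) (Real.exp (a * s) * (a * 1)) s :=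
    ((hasDerivAt_id s).const_mul a).exp
  have hc : Continuous fun τ => Real.exp (-a * τ) * K τ := by fun_prop
  have h2 : HasDerivAt (fun s => ∫ τ in t..s, Real.exp (-a * τ) * K τ)
      (Real.exp (-a * s) * K s) s :=
    intervalIntegral.integral_hasDerivAt_right (hc.intervalIntegrable _ _)
      hc.stronglyMeasurable.stronglyMeasurableAtFilter hc.continuousAt
  refine (h1.mul h2).congr_deriv ?_
  have : Real.exp (a * s) * Real.exp (-a * s) = 1 := by rw [← Real.exp_add]; simp
  linear_combination K s * this

/-- The resolvent `K ↦ K + a ∫_t^· e^{a(· - τ)} K(τ) dτ` of the scalar Volterra equation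
`y = K + a ∫_t^· y`. -/
def volterraSol (a t : ℝ) (K : ℝ → ℝ) (s : ℝ) : ℝ :=
  K s + a * (Real.exp (a * s) * ∫ τ in t..s, Real.exp (-a * τ) * K τ)

lemma continuousOn_volterraSol {K : ℝ → ℝ} {a t T : ℝ} (htT : t ≤ T)
    (hK : ContinuousOn K (Icc t T)) : ContinuousOn (volterraSol a t K) (Icc t T) := by
  have h : ContinuousOn (fun τ => Real.exp (-a * τ) * K τ) (uIcc t T) := by
    rw [uIcc_of_le htT]; exact (by fun_prop : Continuous _).continuousOn.mul hK
  have h2 := intervalIntegral.continuousOn_primitive_interval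
    (h.integrableOn_compact isCompact_uIcc (μ := volume))
  rw [uIcc_of_le htT] at h2
  unfold volterraSol
  exact hK.add (continuousOn_const.mul (ContinuousOn.mul (by fun_prop) h2))

/-- The resolvent solves the Volterra equation. Since `K` itself is not differentiated, the
equation is reduced to the fundamental theorem of calculus, for `K` extended to a continuous
function on `ℝ`. -/
lemma volterraSol_eq {K : ℝ → ℝ} {a t T : ℝ}
    (hK : ContinuousOn K (Icc t T)) {s : ℝ} (hs : s ∈ Icc t T) :
    volterraSol a t K s = K s + a * ∫ τ in t..s, volterraSol a t K τ := by
  have htT : t ≤ T := hs.1.trans hs.2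
  set L : ℝ → ℝ := IccExtend htT ((Icc t T).domRestrict K) with hL
  have hLc : Continuous L := (continuousOn_iff_continuous_domRestrict.1 hK).Icc_extend'
  have hLK : ∀ s ∈ Icc t T, L s = K s := fun s hs => by
    rw [hL, IccExtend_of_mem htT _ hs]; rfl
  have hsol : ∀ s ∈ Icc t T, volterraSol a t K s = volterraSol a t L s := fun s hs => by
    unfold volterraSol
    rw [hLK s hs]
    congr 3
    refine intervalIntegral.integral_congr fun τ hτ => ?_
    rw [uIcc_of_le hs.1] at hτ
    simp only [hLK τ ⟨hτ.1, hτ.2.trans hs.2⟩]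
  have h := intervalIntegral.integral_eq_sub_of_hasDerivAt
    (fun s _ => hasDerivAt_integral_exp_kernel hLc a t s) (a := t) (b := s) (by
      refine Continuous.intervalIntegrable (Continuous.add ?_ hLc) _ _
      refine continuous_const.mul (continuous_iff_continuousAt.2 fun s => ?_)
      exact (hasDerivAt_integral_exp_kernel hLc a t s).continuousAt)
  have h3 : ∫ τ in t..s, volterraSol a t K τ =
      ∫ τ in t..s, (a * (Real.exp (a * τ) * ∫ ρ in t..τ, Real.exp (-a * ρ) * L ρ) + L τ) := by
    refine intervalIntegral.integral_congr fun τ hτ => ?_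
    rw [uIcc_of_le hs.1] at hτ
    rw [hsol τ ⟨hτ.1, hτ.2.trans hs.2⟩, volterraSol, add_comm]
  rw [h3, h, hsol s hs, volterraSol, hLK s hs]
  simp

/-- Uniqueness for the linear Volterra equation among integrable functions: a solution is
automatically continuous, and Grönwall's inequality applies to its primitive. -/
lemma eq_zero_of_volterra {y : ℝ → ℝ} {a t T : ℝ} (hint : IntervalIntegrable y volume t T)
    (hy : ∀ s ∈ Icc t T, y s = a * ∫ τ in t..s, y τ) : ∀ s ∈ Icc t T, y s = 0 := by
  intro s0 hs0
  have htT : t ≤ T := hs0.1.trans hs0.2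
  have hyc : ContinuousOn y (Icc t T) := by
    have h2 := intervalIntegral.continuousOn_primitive_interval
      (f := y) (μ := volume) (a := t) (b := T) (by
        rw [uIcc_of_le htT]; exact (intervalIntegrable_iff_integrableOn_Icc_of_le htT).1 hint)
    rw [uIcc_of_le htT] at h2
    exact (continuousOn_const.mul h2).congr hy
  set L : ℝ → ℝ := IccExtend htT ((Icc t T).domRestrict y) with hL
  have hLc : Continuous L := (continuousOn_iff_continuous_domRestrict.1 hyc).Icc_extend'
  have hLy : ∀ s ∈ Icc t T, L s = y s := fun s hs => by
    rw [hL, IccExtend_of_mem htT _ hs]; rfl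
  have hLe : ∀ s ∈ Icc t T, L s = a * ∫ τ in t..s, L τ := fun s hs => by
    rw [hLy s hs, hy s hs]
    congr 1
    refine intervalIntegral.integral_congr fun τ hτ => ?_
    rw [uIcc_of_le hs.1] at hτ
    exact (hLy τ ⟨hτ.1, hτ.2.trans hs.2⟩).symm
  have hd : ∀ s, HasDerivAt (fun s => ∫ τ in t..s, L τ) (L s) s := fun s =>
    intervalIntegral.integral_hasDerivAt_right (hLc.intervalIntegrable _ _)
      hLc.stronglyMeasurable.stronglyMeasurableAtFilter hLc.continuousAt
  have := eq_zero_of_abs_deriv_le_mul_abs_self_of_eq_zero_right (K := |a|)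
    (f := fun s => ∫ τ in t..s, L τ) (f' := L) (a := t) (b := T)
    (fun s _ => (hd s).continuousAt.continuousWithinAt)
    (fun s _ => (hd s).hasDerivWithinAt) (by simp)
    (fun s hs => by rw [hLe s ⟨hs.1, hs.2.le⟩, norm_mul, Real.norm_eq_abs a]) s0 hs0
  rw [← hLy s0 hs0, hLe s0 hs0]
  rw [this, mul_zero]

/-- Integration by parts against the primitive of an integrable function. -/
lemma integral_deriv_mul_primitive {p p' g : ℝ → ℝ} {t T : ℝ}
    (hp : ∀ s, HasDerivAt p (p' s) s) (hp' : Continuous p')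
    (hg : IntervalIntegrable g volume t T) :
    ∫ s in t..T, p' s * ∫ τ in t..s, g τ = p T * (∫ τ in t..T, g τ) - ∫ s in t..T, p s * g s := by
  have hpc : ContDiff ℝ 1 p := by
    rw [contDiff_one_iff_deriv]
    exact ⟨fun s => (hp s).differentiableAt, by rwa [funext fun s => (hp s).deriv]⟩
  have h1 : AbsolutelyContinuousOnInterval p t T := hpc.contDiffOn.absolutelyContinuousOnInterval
  have h2 : AbsolutelyContinuousOnInterval (fun s => ∫ τ in t..s, g τ) t T :=
    hg.absolutelyContinuousOnInterval_intervalIntegral (by simp)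
  have h3 := h1.integral_mul_deriv_eq_deriv_mul h2
  have h4 : ∫ s in t..T, p s * deriv (fun s => ∫ τ in t..s, g τ) s = ∫ s in t..T, p s * g s := by
    refine intervalIntegral.integral_congr_ae ?_
    filter_upwards [hg.ae_hasDerivAt_integral] with s hs hs'
    rw [(hs (uIoc_subset_uIcc hs') t (by simp)).deriv]
  rw [h4] at h3
  rw [h3, intervalIntegral.integral_same]
  simp only [(hp _).deriv]
  ring

/-! ### The Cauchy–Schwarz inequality for integrals -/

/-- The Cauchy–Schwarz inequality, with squares of real integrals on both sides. -/
lemma sq_integral_mul_le {α : Type*} [MeasurableSpace α] {μ : Measure α} {f g : α → ℝ}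
    (hf : MemLp f 2 μ) (hg : MemLp g 2 μ) :
    (∫ x, f x * g x ∂μ) ^ 2 ≤ (∫ x, f x ^ 2 ∂μ) * ∫ x, g x ^ 2 ∂μ := by
  have hfg : Integrable (fun x => f x * g x) μ := hf.integrable_mul hg
  have hf2 := hf.integrable_sq
  have hg2 := hg.integrable_sq
  have key : ∀ s : ℝ, 0 ≤ (∫ x, f x ^ 2 ∂μ) * (s * s) + (2 * ∫ x, f x * g x ∂μ) * s +
      ∫ x, g x ^ 2 ∂μ := fun s => by
    have : 0 ≤ ∫ x, (s * f x + g x) ^ 2 ∂μ := integral_nonneg fun x => sq_nonneg _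
    have e : ∫ x, (s * f x + g x) ^ 2 ∂μ =
        ∫ x, ((s * s) * f x ^ 2 + (2 * s) * (f x * g x) + g x ^ 2) ∂μ := by
      congr 1; ext x; ring
    have hi1 : Integrable (fun x => s * s * f x ^ 2) μ := hf2.const_mul _
    have hi2 : Integrable (fun x => 2 * s * (f x * g x)) μ := hfg.const_mul _
    rw [e, integral_add (hi1.add hi2 : Integrable (fun x => _ + _) μ) hg2,
      integral_add hi1 hi2, integral_const_mul, integral_const_mul] at this
    linarith
  have := discrim_le_zero key
  unfold discrim at this
  nlinarith

lemma sq_integral_le {α : Type*} [MeasurableSpace α] {μ : Measure α} [IsFiniteMeasure μ]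
    {f : α → ℝ} (hf : MemLp f 2 μ) :
    (∫ x, f x ∂μ) ^ 2 ≤ μ.real univ * ∫ x, f x ^ 2 ∂μ := by
  have := sq_integral_mul_le (memLp_const (1 : ℝ)) hf
  simpa using this

/-! ### Progressively measurable square integrable processes -/

section Stochastic

variable {Ω : Type*} {mΩ : MeasurableSpace Ω}

/-- Joint measurability on `S × Ω` is joint measurability on `ℝ × Ω` of the extension by `0`. -/
lemma measurable_uncurry_indicator {Ω : Type*} {m : MeasurableSpace Ω} {S : Set ℝ}
    (hS : MeasurableSet S) {u : ℝ → Ω → ℝ} :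
    Measurable (fun p : S × Ω => u p.1 p.2) ↔
      Measurable (fun p : ℝ × Ω => S.indicator (fun τ => u τ p.2) p.1) := by
  constructor
  · intro h
    refine measurable_of_restrict_of_restrict_compl (hS.prod MeasurableSet.univ) ?_ ?_
    · convert h.comp (f := fun q : (S ×ˢ (univ : Set Ω) : Set (ℝ × Ω)) =>
        ((⟨q.1.1, q.2.1⟩ : S), q.1.2)) (by fun_prop) using 1
      ext q
      exact indicator_of_mem q.2.1 (fun τ => u τ q.1.2)
    · convert measurable_const (a := (0 : ℝ)) using 1
      ext q
      exact indicator_of_notMem (fun hq => q.2 ⟨hq, mem_univ _⟩) (fun τ => u τ q.1.2)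
  · intro h
    have := h.comp (f := fun p : S × Ω => ((p.1 : ℝ), p.2)) (by fun_prop)
    convert this using 2 with p
    simp [p.1.2]

/-- Joint measurability of `(s, ω) ↦ ∫_t^s F(τ, ω) dτ`, for an arbitrary σ-algebra on `Ω`. It is
used for the σ-algebras of a filtration. -/
lemma measurable_uncurry_primitive {Ω : Type*} {m : MeasurableSpace Ω} {F : ℝ → Ω → ℝ}
    (hF : Measurable (Function.uncurry F)) (t : ℝ) :
    Measurable fun p : ℝ × Ω => ∫ τ, (Ioc t p.1).indicator (fun τ => F τ p.2) τ := by
  refine (StronglyMeasurable.integral_prod_right (ν := volume)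
    (f := fun (p : ℝ × Ω) τ => (Ioc t p.1).indicator (fun τ => F τ p.2) τ) ?_).measurable
  refine Measurable.stronglyMeasurable ?_
  have he : (Function.uncurry fun (p : ℝ × Ω) τ => (Ioc t p.1).indicator (fun τ => F τ p.2) τ) =
      {q : (ℝ × Ω) × ℝ | t < q.2 ∧ q.2 ≤ q.1.1}.indicator (fun q => F q.2 q.1.2) := by
    ext ⟨p, τ⟩; simp [indicator]
  rw [he]
  refine Measurable.indicator (hF.comp (f := fun q : (ℝ × Ω) × ℝ => (q.2, q.1.2)) (by fun_prop)) ?_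
  exact (measurableSet_lt measurable_const measurable_snd).inter
    (measurableSet_le measurable_snd (measurable_fst.comp measurable_fst))

/-- Progressive measurability in terms of processes extended by `0`, to which the measurability
lemmas on `ℝ × Ω` apply. -/
lemma progressiveOn_iff {ℱ : Filtration ℝ≥0 mΩ} {a b : ℝ} {u : ℝ → Ω → ℝ} :
    ProgressiveOn ℱ a b u ↔ ∀ s ∈ Icc a b, Measurable[(borel ℝ).prod (ℱ s.toNNReal)]
      fun p : ℝ × Ω => (Icc a s).indicator (fun τ => u τ p.2) p.1 :=
  forall₂_congr fun s _ =>
    measurable_uncurry_indicator (m := ℱ s.toNNReal) (u := u) measurableSet_Icc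

lemma ProgressiveOn.primitive {ℱ : Filtration ℝ≥0 mΩ} {a b : ℝ} {u : ℝ → Ω → ℝ}
    (hu : ProgressiveOn ℱ a b u) : ProgressiveOn ℱ a b (fun s ω => ∫ τ in a..s, u τ ω) := by
  intro s hs
  have h := measurable_uncurry_primitive (m := ℱ s.toNNReal)
    (F := fun τ ω => (Icc a s).indicator (fun τ => u τ ω) τ) (progressiveOn_iff.1 hu s hs) a
  have h2 := h.comp (f := fun p : Icc a s × Ω => ((p.1 : ℝ), p.2))
    ((measurable_subtype_coe.comp measurable_fst).prodMk measurable_snd)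
  refine (congrArg (fun f => Measurable[Subtype.instMeasurableSpace.prod (ℱ s.toNNReal)] f)
    (funext fun p => ?_)).mp h2
  simp only [Function.comp_apply]
  rw [integral_indicator measurableSet_Ioc, intervalIntegral.integral_of_le p.1.2.1]
  refine setIntegral_congr_fun measurableSet_Ioc fun τ hτ => ?_
  rw [indicator_of_mem]
  exact ⟨hτ.1.le, hτ.2.trans p.1.2.2⟩

lemma ProgressiveOn.add {ℱ : Filtration ℝ≥0 mΩ} {a b : ℝ} {u v : ℝ → Ω → ℝ}
    (hu : ProgressiveOn ℱ a b u) (hv : ProgressiveOn ℱ a b v) :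
    ProgressiveOn ℱ a b (fun s ω => u s ω + v s ω) := fun s hs =>
  Measurable.add (hu s hs) (hv s hs)

lemma ProgressiveOn.of_measurable {ℱ : Filtration ℝ≥0 mΩ} {a b : ℝ} {f : ℝ → ℝ}
    (hf : Measurable fun s : Icc a b => f s) : ProgressiveOn ℱ a b (fun s _ => f s) := fun s hs =>
  hf.comp (f := fun p : Icc a s × Ω => (⟨p.1, p.1.2.1, p.1.2.2.trans hs.2⟩ : Icc a b))
    (by
      refine Measurable.subtype_mk ?_
      exact measurable_subtype_coe.comp measurable_fst)

lemma ProgressiveOn.mul {ℱ : Filtration ℝ≥0 mΩ} {a b : ℝ} {u v : ℝ → Ω → ℝ}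
    (hu : ProgressiveOn ℱ a b u) (hv : ProgressiveOn ℱ a b v) :
    ProgressiveOn ℱ a b (fun s ω => u s ω * v s ω) := fun s hs =>
  Measurable.mul (hu s hs) (hv s hs)

lemma ProgressiveOn.mono {ℱ : Filtration ℝ≥0 mΩ} {a a' b : ℝ} {u : ℝ → Ω → ℝ}
    (hu : ProgressiveOn ℱ a b u) (h : a ≤ a') : ProgressiveOn ℱ a' b u := fun s hs =>
  (hu s ⟨h.trans hs.1, hs.2⟩).comp (f := fun p : Icc a' s × Ω =>
    ((⟨p.1, h.trans p.1.2.1, p.1.2.2⟩ : Icc a s), p.2))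
    (by
      refine Measurable.prodMk (Measurable.subtype_mk ?_) measurable_snd
      exact measurable_subtype_coe.comp measurable_fst)

variable {P : Measure Ω}

lemma ProgressiveOn.aestronglyMeasurable {ℱ : Filtration ℝ≥0 mΩ} {a b : ℝ} {u : ℝ → Ω → ℝ}
    (hu : ProgressiveOn ℱ a b u) (hab : a ≤ b) :
    AEStronglyMeasurable (Function.uncurry u) ((volume.restrict (Icc a b)).prod P) := by
  have h := progressiveOn_iff.1 hu b (right_mem_Icc.2 hab)
  have h2 : Measurable fun p : ℝ × Ω => (Icc a b).indicator (fun τ => u τ p.2) p.1 :=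
    h.mono (sup_le_sup le_rfl (MeasurableSpace.comap_mono (ℱ.le _))) le_rfl
  refine h2.aestronglyMeasurable.congr ?_
  have h3 : ∀ᵐ p ∂((volume.restrict (Icc a b)).prod P), p.1 ∈ Icc a b :=
    Measure.quasiMeasurePreserving_fst.ae (ae_restrict_mem measurableSet_Icc)
  filter_upwards [h3] with p hp
  simp [Function.uncurry, indicator_of_mem hp]

variable {ℱ : Filtration ℝ≥0 mΩ} {a b : ℝ} {u v : ℝ → Ω → ℝ}

lemma ae_ae_of_ae_snd {μ : Measure ℝ} {p : Ω → Prop} (h : ∀ᵐ ω ∂P, p ω) :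
    ∀ᵐ q ∂(μ.prod P), p q.2 :=
  Measure.quasiMeasurePreserving_snd.ae h

lemma MemL2Prog.add (hu : MemL2Prog P ℱ a b u) (hv : MemL2Prog P ℱ a b v) :
    MemL2Prog P ℱ a b (fun s ω => u s ω + v s ω) :=
  ⟨hu.progressive.add hv.progressive, hu.memLp.add hv.memLp⟩

lemma MemL2Prog.mul_continuousOn {f : ℝ → ℝ} (hab : a ≤ b) (hu : MemL2Prog P ℱ a b u)
    (hf : ContinuousOn f (Icc a b)) : MemL2Prog P ℱ a b (fun s ω => f s * u s ω) := by
  have hp := (ProgressiveOn.of_measurable (ℱ := ℱ) hf.domRestrict.measurable).mul hu.progressive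
  obtain ⟨C, hC⟩ := isCompact_Icc.exists_bound_of_continuousOn hf
  refine ⟨hp, hu.memLp.of_le_mul (c := C) (hp.aestronglyMeasurable hab) ?_⟩
  have h3 : ∀ᵐ p ∂((volume.restrict (Icc a b)).prod P), p.1 ∈ Icc a b :=
    Measure.quasiMeasurePreserving_fst.ae (ae_restrict_mem measurableSet_Icc)
  filter_upwards [h3] with p hp
  simp only [Function.uncurry, norm_mul]
  gcongr
  exact hC _ hp

lemma MemL2Prog.const_mul (hab : a ≤ b) (hu : MemL2Prog P ℱ a b u) (c : ℝ) :
    MemL2Prog P ℱ a b (fun s ω => c * u s ω) :=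
  hu.mul_continuousOn hab continuousOn_const

variable [IsProbabilityMeasure P]

lemma MemL2Prog.integrable (hu : MemL2Prog P ℱ a b u) :
    Integrable (Function.uncurry u) ((volume.restrict (Icc a b)).prod P) :=
  hu.memLp.integrable one_le_two

lemma memLp_slice_right {μ : Measure ℝ} [SFinite μ]
    (hu : MemLp (Function.uncurry u) 2 (μ.prod P)) : ∀ᵐ ω ∂P, MemLp (fun s => u s ω) 2 μ := by
  have h := hu.integrable_sq.prod_left_ae
  have h2 := hu.aestronglyMeasurable.prodMk_right
  filter_upwards [h, h2] with ω h h2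
  exact (memLp_two_iff_integrable_sq h2).2 h

lemma memLp_slice_left {μ : Measure ℝ} [SFinite μ]
    (hu : MemLp (Function.uncurry u) 2 (μ.prod P)) : ∀ᵐ s ∂μ, MemLp (u s) 2 P := by
  have h := hu.integrable_sq.prod_right_ae
  have h2 := hu.aestronglyMeasurable.prodMk_left
  filter_upwards [h, h2] with ω h h2
  exact (memLp_two_iff_integrable_sq h2).2 h

/-- Jensen's inequality at almost every time. -/
lemma sq_mean_le {μ : Measure ℝ} [SFinite μ]
    (hu : MemLp (Function.uncurry u) 2 (μ.prod P)) :
    ∀ᵐ s ∂μ, (∫ ω, u s ω ∂P) ^ 2 ≤ ∫ ω, u s ω ^ 2 ∂P := by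
  filter_upwards [memLp_slice_left hu] with s hs
  simpa using sq_integral_le hs

lemma memLp_mean {μ : Measure ℝ} [SFinite μ]
    (hu : MemLp (Function.uncurry u) 2 (μ.prod P)) : MemLp (fun s => ∫ ω, u s ω ∂P) 2 μ := by
  have hm : AEStronglyMeasurable (fun s => ∫ ω, u s ω ∂P) μ :=
    hu.aestronglyMeasurable.integral_prod_right'
  refine (memLp_two_iff_integrable_sq hm).2 ?_
  refine hu.integrable_sq.integral_prod_left.mono' (hm.pow 2) ?_
  filter_upwards [sq_mean_le hu] with s hs
  rwa [Real.norm_of_nonneg (sq_nonneg _)]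

lemma MemL2Prog.slice (hu : MemL2Prog P ℱ a b u) (hab : a ≤ b) :
    ∀ᵐ ω ∂P, IntervalIntegrable (fun s => u s ω) volume a b := by
  filter_upwards [memLp_slice_right hu.memLp] with ω h
  exact (intervalIntegrable_iff_integrableOn_Icc_of_le hab).2 (h.integrable one_le_two)

lemma MemL2Prog.of_continuousOn {f : ℝ → ℝ} (hf : ContinuousOn f (Icc a b)) :
    MemL2Prog P ℱ a b (fun s _ => f s) where
  progressive := .of_measurable hf.domRestrict.measurable
  memLp := by
    obtain ⟨C, hC⟩ := isCompact_Icc.exists_bound_of_continuousOn hf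
    have : MemLp f 2 (volume.restrict (Icc a b)) :=
      MemLp.of_bound (hf.aestronglyMeasurable measurableSet_Icc) C
        (ae_restrict_of_forall_mem measurableSet_Icc hC)
    exact this.comp_fst P

/-- The primitive of a process in `L²_𝒫` is in `L²_𝒫`; the square of the primitive is controlled,
uniformly in time, by the Cauchy–Schwarz inequality on each path. -/
lemma MemL2Prog.primitive (hab : a ≤ b) (hu : MemL2Prog P ℱ a b u) :
    MemL2Prog P ℱ a b (fun s ω => ∫ τ in a..s, u τ ω) := by
  have hp := hu.progressive.primitive
  have hm := hp.aestronglyMeasurable (P := P) hab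
  refine ⟨hp, (memLp_two_iff_integrable_sq hm).2 ?_⟩
  have hi : Integrable (fun p : ℝ × Ω => (b - a) * ∫ τ in Icc a b, u τ p.2 ^ 2)
      ((volume.restrict (Icc a b)).prod P) :=
    (hu.memLp.integrable_sq.integral_prod_right.comp_snd _).const_mul _
  refine hi.mono' (hm.pow 2) ?_
  have h3 : ∀ᵐ p ∂((volume.restrict (Icc a b)).prod P), p.1 ∈ Icc a b :=
    Measure.quasiMeasurePreserving_fst.ae (ae_restrict_mem measurableSet_Icc)
  filter_upwards [h3, ae_ae_of_ae_snd (memLp_slice_right hu.memLp)] with p hp hL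
  rw [Real.norm_of_nonneg (sq_nonneg _), Function.uncurry]
  have hsub : Ioc a p.1 ⊆ Icc a b := fun τ hτ => ⟨hτ.1.le, hτ.2.trans hp.2⟩
  have hL' : MemLp (fun s => u s p.2) 2 (volume.restrict (Ioc a p.1)) :=
    hL.mono_measure (Measure.restrict_mono hsub le_rfl)
  rw [intervalIntegral.integral_of_le hp.1]
  refine (sq_integral_le hL').trans ?_
  have h1 : (volume.restrict (Ioc a p.1)).real univ = p.1 - a := by
    simp [measureReal_def, hp.1]
  rw [h1]
  have h2 : ∫ τ in Ioc a p.1, u τ p.2 ^ 2 ≤ ∫ τ in Icc a b, u τ p.2 ^ 2 :=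
    setIntegral_mono_set hL.integrable_sq (ae_of_all _ fun _ => sq_nonneg _)
      (Filter.Eventually.of_forall hsub)
  have h4 : 0 ≤ ∫ τ in Ioc a p.1, u τ p.2 ^ 2 := integral_nonneg fun _ => sq_nonneg _
  have h5 := hp.1
  have h6 := hp.2
  gcongr

/-- Fubini for the expectation of a primitive. -/
lemma MemL2Prog.integral_primitive (hu : MemL2Prog P ℱ a b u) {s : ℝ} (hs : s ∈ Icc a b) :
    Integrable (fun ω => ∫ τ in a..s, u τ ω) P ∧
      ∫ ω, (∫ τ in a..s, u τ ω) ∂P = ∫ τ in a..s, ∫ ω, u τ ω ∂P := by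
  have hsub : Ioc a s ⊆ Icc a b := fun τ hτ => ⟨hτ.1.le, hτ.2.trans hs.2⟩
  have hi : Integrable (Function.uncurry u) ((volume.restrict (Ioc a s)).prod P) :=
    hu.integrable.mono_measure (Measure.prod_mono (Measure.restrict_mono hsub le_rfl) le_rfl)
  simp only [intervalIntegral.integral_of_le hs.1]
  exact ⟨hi.integral_prod_right, (integral_integral_swap hi).symm⟩

lemma MemL2Prog.continuousOn_primitive (hu : MemL2Prog P ℱ a b u) (hab : a ≤ b) :
    ∀ᵐ ω ∂P, ContinuousOn (fun s => ∫ τ in a..s, u τ ω) (Icc a b) := by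
  filter_upwards [hu.slice hab] with ω h
  have h2 := intervalIntegral.continuousOn_primitive_interval
    (f := fun s => u s ω) (μ := volume) (a := a) (b := b) (by
      rw [uIcc_of_le hab]; exact (intervalIntegrable_iff_integrableOn_Icc_of_le hab).1 h)
  rwa [uIcc_of_le hab] at h2

end Stochastic

/-! ### The delayed control -/

/-- A square integrable function on a set of finite measure has a Borel version which vanishes
off that set. -/
lemma exists_measurable_supported {f : ℝ → ℝ} {S : Set ℝ} (hS : MeasurableSet S)
    (hSf : volume S ≠ ∞) (hf : MemLp f 2 (volume.restrict S)) :
    ∃ g : ℝ → ℝ, Measurable g ∧ MemLp g 2 ∧ Integrable g ∧ (∀ ξ ∉ S, g ξ = 0) ∧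
      ∀ᵐ ξ, ξ ∈ S → f ξ = g ξ := by
  have hm := hf.aestronglyMeasurable
  have hg : MemLp (hm.mk f) 2 (volume.restrict S) := hf.ae_eq hm.ae_eq_mk
  have : IsFiniteMeasure (volume.restrict S) := ⟨by simpa using hSf.lt_top⟩
  refine ⟨S.indicator (hm.mk f), hm.stronglyMeasurable_mk.measurable.indicator hS,
    (memLp_indicator_iff_restrict hS).2 hg,
    (integrable_indicator_iff hS).2 (hg.integrable one_le_two),
    fun ξ hξ => indicator_of_notMem hξ _, ?_⟩
  filter_upwards [(ae_restrict_iff' hS).1 hm.ae_eq_mk] with ξ hξ hξS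
  rw [indicator_of_mem hξS, hξ hξS]

/-- A Borel version of `b₁`, extended by `0` outside `[-d, 0]`. -/
def Model.kern (M : Model) : ℝ → ℝ :=
  (exists_measurable_supported measurableSet_Icc (by simp) M.b1_memLp).choose

/-- A Borel version of the past control `δ`, extended by `0` outside `[-d, 0]`. -/
def Model.past (M : Model) : ℝ → ℝ :=
  (exists_measurable_supported measurableSet_Icc (by simp) M.δ_memLp).choose

lemma Model.kern_spec (M : Model) : Measurable M.kern ∧ MemLp M.kern 2 ∧ Integrable M.kern ∧
    (∀ ξ ∉ Icc (-M.d) 0, M.kern ξ = 0) ∧ ∀ᵐ ξ, ξ ∈ Icc (-M.d) 0 → M.b1 ξ = M.kern ξ :=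
  (exists_measurable_supported measurableSet_Icc (by simp) M.b1_memLp).choose_spec

lemma Model.past_spec (M : Model) : Measurable M.past ∧ MemLp M.past 2 ∧ Integrable M.past ∧
    (∀ ξ ∉ Icc (-M.d) 0, M.past ξ = 0) ∧ ∀ᵐ ξ, ξ ∈ Icc (-M.d) 0 → M.δ ξ = M.past ξ :=
  (exists_measurable_supported measurableSet_Icc (by simp) M.δ_memLp).choose_spec

section Stochastic

variable {Ω : Type*} {mΩ : MeasurableSpace Ω}

/-- The control on the whole time line: the past `δ` up to time `t`, then `u` up to time `T`,
and `0` elsewhere. -/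
def Model.ctl (M : Model) (t : ℝ) (u : ℝ → Ω → ℝ) (s : ℝ) (ω : Ω) : ℝ :=
  M.past (s - t) + (Ioc t M.T).indicator (fun τ => u τ ω) s

/-- The delayed influence `∫ b₁(ξ) u(s + ξ) dξ` of the control. -/
def Model.delay (M : Model) (t : ℝ) (u : ℝ → Ω → ℝ) (s : ℝ) (ω : Ω) : ℝ :=
  ∫ ξ, M.kern ξ * M.ctl t u (s + ξ) ω

/-- The delay term of the drift is unchanged when `b₁` and `δ` are replaced by their Borel versions,
because at each time this modifies the integrand on a null set only. -/
lemma Model.delay_eq (M : Model) {t s : ℝ} (u : ℝ → Ω → ℝ) (hs : s ∈ Icc t M.T) (ω : Ω) :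
    ∫ ξ in (-M.d)..0, M.b1 ξ * M.extend t u (s + ξ) ω = M.delay t u s ω := by
  have hd := M.d_nonneg
  rw [intervalIntegral.integral_of_le (by linarith), ← integral_Icc_eq_integral_Ioc, Model.delay,
    ← setIntegral_eq_integral_of_forall_compl_eq_zero (s := Icc (-M.d) 0)
      (f := fun ξ => M.kern ξ * M.ctl t u (s + ξ) ω)
      (fun ξ hξ => by rw [M.kern_spec.2.2.2.1 ξ hξ, zero_mul])]
  refine setIntegral_congr_ae measurableSet_Icc ?_
  have h2 : ∀ᵐ ξ, s - t + ξ ∈ Icc (-M.d) 0 → M.δ (s - t + ξ) = M.past (s - t + ξ) :=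
    (measurePreserving_add_left volume (s - t)).quasiMeasurePreserving.ae M.past_spec.2.2.2.2
  filter_upwards [M.kern_spec.2.2.2.2, h2] with ξ h1 h2 hξ
  rw [h1 hξ, Model.extend, Model.ctl]
  have he : s + ξ - t = s - t + ξ := by ring
  congr 1
  split_ifs with h
  · rw [he, h2 ⟨by linarith [hs.1, hξ.1], by linarith⟩, indicator_of_notMem (fun h' => ?_),
      add_zero]
    exact absurd h'.1 (not_lt.2 h)
  · rw [M.past_spec.2.2.2.1 _ (fun h' => h (by linarith [h'.2])), zero_add, indicator_of_mem]
    exact ⟨not_le.1 h, by linarith [hs.2, hξ.2]⟩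

/-- Joint measurability of the delay integral, for an arbitrary σ-algebra on `Ω`. -/
lemma measurable_uncurry_convolution {Ω : Type*} {m : MeasurableSpace Ω} {β : ℝ → ℝ}
    (hβ : Measurable β) {F : ℝ → Ω → ℝ} (hF : Measurable (Function.uncurry F)) :
    Measurable fun p : ℝ × Ω => ∫ ξ, β ξ * F (p.1 + ξ) p.2 := by
  refine (StronglyMeasurable.integral_prod_right (ν := volume)
    (f := fun (p : ℝ × Ω) ξ => β ξ * F (p.1 + ξ) p.2) ?_).measurable
  refine Measurable.stronglyMeasurable ?_
  exact (hβ.comp measurable_snd).mul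
    (hF.comp (f := fun q : (ℝ × Ω) × ℝ => (q.1.1 + q.2, q.1.2)) (by fun_prop))

/-- The delay term at time `s` involves the control up to time `s` only, so it is progressive. -/
lemma Model.progressiveOn_delay (M : Model) {ℱ : Filtration ℝ≥0 mΩ} {t : ℝ} (ht : 0 ≤ t)
    {u : ℝ → Ω → ℝ} (hu : ProgressiveOn ℱ 0 M.T u) : ProgressiveOn ℱ t M.T (M.delay t u) := by
  intro s hs
  have h1 := progressiveOn_iff.1 (hu.mono ht) s hs
  have h2 : Measurable[(borel ℝ).prod (ℱ s.toNNReal)]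
      fun p : ℝ × Ω => M.past (p.1 - t) +
        (Ioi t).indicator (fun τ => (Icc t s).indicator (fun τ => u τ p.2) τ) p.1 := by
    refine Measurable.add ?_ ?_
    · exact (M.past_spec.1.comp (measurable_id.sub_const t)).comp measurable_fst
    · have : (fun p : ℝ × Ω =>
          (Ioi t).indicator (fun τ => (Icc t s).indicator (fun τ => u τ p.2) τ) p.1) =
          (Prod.fst ⁻¹' (Ioi t)).indicator
            (fun p : ℝ × Ω => (Icc t s).indicator (fun τ => u τ p.2) p.1) := by
        ext p; simp [indicator]
      rw [this]
      exact h1.indicator (measurable_fst measurableSet_Ioi)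
  have h3 := (measurable_uncurry_convolution (m := ℱ s.toNNReal) M.kern_spec.1
    (F := fun τ ω => M.past (τ - t) +
        (Ioi t).indicator (fun τ => (Icc t s).indicator (fun τ => u τ ω) τ) τ) h2).comp
    (f := fun p : Icc t s × Ω => ((p.1 : ℝ), p.2))
    ((measurable_subtype_coe.comp measurable_fst).prodMk measurable_snd)
  refine (congrArg (fun f => Measurable[Subtype.instMeasurableSpace.prod (ℱ s.toNNReal)] f)
    (funext fun p => ?_)).mp h3
  simp only [Function.comp_apply]
  unfold Model.delay Model.ctl
  congr 1
  ext ξ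
  by_cases hξ : ξ ∈ Icc (-M.d) 0
  · congr 2
    have h1 : (p.1 : ℝ) + ξ ≤ s := by linarith [p.1.2.2, hξ.2]
    by_cases h : t < p.1 + ξ
    · rw [indicator_of_mem (mem_Ioi.2 h), indicator_of_mem (mem_Icc.2 ⟨h.le, h1⟩),
        indicator_of_mem (mem_Ioc.2 ⟨h, h1.trans hs.2⟩)]
    · rw [indicator_of_notMem (by simpa using h), indicator_of_notMem (fun h' => h h'.1)]
  · rw [M.kern_spec.2.2.2.1 ξ hξ, zero_mul, zero_mul]

variable {P : Measure Ω} [IsProbabilityMeasure P]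

lemma memLp_indicator_uncurry {u : ℝ → Ω → ℝ} {a b t : ℝ} (hat : a ≤ t)
    (hu : MemLp (Function.uncurry u) 2 ((volume.restrict (Icc a b)).prod P)) :
    MemLp (Function.uncurry fun s ω => (Ioc t b).indicator (fun τ => u τ ω) s) 2
      (volume.prod P) := by
  have h : MemLp (Function.uncurry u) 2 ((volume.prod P).restrict (Ioc t b ×ˢ univ)) := by
    rw [← Measure.prod_restrict, Measure.restrict_univ]
    refine hu.mono_measure (Measure.prod_mono (Measure.restrict_mono ?_ le_rfl) le_rfl)
    exact fun s hs => ⟨hat.trans hs.1.le, hs.2⟩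
  have h2 := (memLp_indicator_iff_restrict (measurableSet_Ioc.prod MeasurableSet.univ)).2 h
  convert h2 using 1
  ext ⟨s, ω⟩
  simp [indicator, Function.uncurry]

lemma Model.memLp_past_sub (M : Model) (t : ℝ) : MemLp (fun s => M.past (s - t)) 2 :=
  M.past_spec.2.1.comp_measurePreserving (measurePreserving_sub_right volume t)

lemma Model.memLp_ctl (M : Model) {t : ℝ} (ht : 0 ≤ t) {u : ℝ → Ω → ℝ}
    (hu : MemLp (Function.uncurry u) 2 ((volume.restrict (Icc 0 M.T)).prod P)) :
    MemLp (Function.uncurry (M.ctl t u)) 2 (volume.prod P) :=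
  ((M.memLp_past_sub t).comp_fst P).add (memLp_indicator_uncurry ht hu)

/-- By the Cauchy–Schwarz inequality on each path, the delay term is bounded uniformly in time by
the `L²` norms of `b₁` and of the control. -/
lemma Model.memL2Prog_delay (M : Model) {ℱ : Filtration ℝ≥0 mΩ} {t : ℝ} (ht : 0 ≤ t)
    (htT : t ≤ M.T) {u : ℝ → Ω → ℝ} (hu : MemL2Prog P ℱ 0 M.T u) :
    MemL2Prog P ℱ t M.T (M.delay t u) := by
  have hp := M.progressiveOn_delay ht hu.progressive
  have hm := hp.aestronglyMeasurable (P := P) htT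
  have hV := M.memLp_ctl ht hu.memLp
  refine ⟨hp, (memLp_two_iff_integrable_sq hm).2 ?_⟩
  have hi : Integrable (fun p : ℝ × Ω => (∫ ξ, M.kern ξ ^ 2) * ∫ v, M.ctl t u v p.2 ^ 2)
      ((volume.restrict (Icc t M.T)).prod P) :=
    (hV.integrable_sq.integral_prod_right.comp_snd _).const_mul _
  refine hi.mono' (hm.pow 2) ?_
  filter_upwards [ae_ae_of_ae_snd (memLp_slice_right hV)] with p hL
  rw [Real.norm_of_nonneg (sq_nonneg _), Function.uncurry, Model.delay]
  refine (sq_integral_mul_le M.kern_spec.2.1 (hL.comp_measurePreserving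
    (measurePreserving_add_left volume p.1))).trans_eq ?_
  congr 1
  exact integral_add_left_eq_self (fun v => M.ctl t u v p.2 ^ 2) p.1

/-- The mean of the delayed control is the delayed mean control. -/
lemma Model.mean_delay (M : Model) {t : ℝ} (ht : 0 ≤ t) {u : ℝ → Ω → ℝ}
    (hu : MemLp (Function.uncurry u) 2 ((volume.restrict (Icc 0 M.T)).prod P)) (s : ℝ) :
    ∫ ω, M.delay t u s ω ∂P = ∫ ξ, M.kern ξ * (M.past (s + ξ - t) +
      (Ioc t M.T).indicator (fun τ => ∫ ω, u τ ω ∂P) (s + ξ)) := by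
  have hV := M.memLp_ctl ht hu
  have hsh : MeasurePreserving (fun p : ℝ × Ω => (s + p.1, p.2)) (volume.prod P)
      (volume.prod P) := (measurePreserving_add_left volume s).prod (MeasurePreserving.id P)
  have hV2 : MemLp (fun p : ℝ × Ω => M.ctl t u (s + p.1) p.2) 2 (volume.prod P) :=
    hV.comp_measurePreserving hsh
  have hi : Integrable (Function.uncurry fun ξ ω => M.kern ξ * M.ctl t u (s + ξ) ω)
      (volume.prod P) := (M.kern_spec.2.1.comp_fst P).integrable_mul hV2
  unfold Model.delay
  rw [← integral_integral_swap hi]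
  refine integral_congr_ae ?_
  have h2 := (measurePreserving_add_left volume s).quasiMeasurePreserving.ae
    (memLp_slice_left (memLp_indicator_uncurry ht hu))
  filter_upwards [h2] with ξ hξ
  rw [integral_const_mul]
  unfold Model.ctl
  rw [integral_add (integrable_const _) (hξ.integrable one_le_two)]
  simp only [integral_const, probReal_univ, one_smul]
  congr 2
  by_cases h : s + ξ ∈ Ioc t M.T <;> simp [h]

end Stochastic

/-- Fubini for a weighted convolution, moving the weight onto the kernel. -/
lemma integral_mul_convolution {β V p : ℝ → ℝ} (hβ : Integrable β) (hV : Integrable V)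
    {C : ℝ} (hp : Measurable p) (hC : ∀ s, |p s| ≤ C) :
    Integrable (fun v => V v * ∫ ξ, β ξ * p (v - ξ)) ∧
      ∫ τ, p τ * ∫ ξ, β ξ * V (τ + ξ) = ∫ v, V v * ∫ ξ, β ξ * p (v - ξ) := by
  have h1 : Integrable (Function.uncurry fun v ξ => V v * (β ξ * p (v - ξ)))
      (volume.prod volume) := by
    have := (hV.mul_prod hβ).mul_bdd (c := C) (g := fun q : ℝ × ℝ => p (q.1 - q.2))
      (hp.comp (measurable_fst.sub measurable_snd)).aestronglyMeasurable (ae_of_all _ fun q => hC _)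
    refine this.congr (ae_of_all _ fun q => ?_)
    simp only [Function.uncurry]; ring
  have hsh : MeasurePreserving (fun q : ℝ × ℝ => (q.1 + q.2, q.2)) (volume.prod volume)
      (volume.prod volume) := measurePreserving_add_prod volume volume
  have h2 : Integrable (Function.uncurry fun τ ξ => p τ * (β ξ * V (τ + ξ)))
      (volume.prod volume) := by
    refine (hsh.integrable_comp_of_integrable h1).congr (ae_of_all _ fun q => ?_)
    simp only [Function.uncurry, Function.comp, add_sub_cancel_right]; ring
  refine ⟨by simpa only [Function.uncurry, integral_const_mul] using h1.integral_prod_left, ?_⟩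
  simp only [← integral_const_mul]
  rw [integral_integral_swap h2, integral_integral_swap h1]
  congr 1
  ext ξ
  rw [← integral_add_right_eq_self (fun v => V v * (β ξ * p (v - ξ))) ξ]
  congr 1
  ext τ
  rw [add_sub_cancel_right]; ring

/-! ### The driving noise -/

section Stochastic

variable {Ω : Type*} {mΩ : MeasurableSpace Ω} {P : Measure Ω} [IsProbabilityMeasure P]

open Classical in
/-- The Brownian motion `W`, set to `0` on the null set of its discontinuous paths. -/
def contVersion (W : ℝ≥0 → Ω → ℝ) (i : ℝ≥0) (ω : Ω) : ℝ :=
  if Continuous (W · ω) then W i ω else 0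

omit mΩ in
lemma continuous_contVersion (W : ℝ≥0 → Ω → ℝ) (ω : Ω) :
    Continuous fun i => contVersion W i ω := by
  unfold contVersion
  split_ifs with h
  · exact h
  · exact continuous_const

omit [IsProbabilityMeasure P] in
/-- The continuous version is still adapted, since the augmented σ-algebras contain the null set of
discontinuous paths. -/
lemma measurable_contVersion [P.IsComplete] {W : ℝ≥0 → Ω → ℝ} (hW : IsBrownianReal W P)
    {i j : ℝ≥0} (hij : i ≤ j) : Measurable[augFiltration W P hW j] (contVersion W i) := by
  classical
  have hA : MeasurableSet[augFiltration W P hW j] {ω | Continuous (W · ω)} := by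
    refine MeasurableSet.of_compl ?_
    have h : MeasurableSet[MeasurableSpace.generateFrom {N : Set Ω | P N = 0}]
        {ω | Continuous (W · ω)}ᶜ := MeasurableSpace.measurableSet_generateFrom hW.cont
    exact (le_sup_right : _ ≤ (augFiltration W P hW j)) _ h
  have hWi : Measurable[augFiltration W P hW j] (W i) := by
    rw [measurable_iff_comap_le]
    exact le_sup_of_le_left (le_iSup₂_of_le i hij le_rfl)
  exact Measurable.ite hA hWi measurable_const

/-- The increments of the Brownian motion since time `t`, as a process with continuous paths
indexed by the real line. -/
def noise (W : ℝ≥0 → Ω → ℝ) (t s : ℝ) (ω : Ω) : ℝ :=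
  contVersion W s.toNNReal ω - contVersion W t.toNNReal ω

omit mΩ in
lemma continuous_noise (W : ℝ≥0 → Ω → ℝ) (t : ℝ) (ω : Ω) : Continuous fun s => noise W t s ω :=
  ((continuous_contVersion W ω).comp continuous_real_toNNReal).sub continuous_const

omit [IsProbabilityMeasure P] in
lemma noise_ae_eq {W : ℝ≥0 → Ω → ℝ} (hW : IsBrownianReal W P) (t : ℝ) :
    ∀ᵐ ω ∂P, ∀ s, noise W t s ω = W s.toNNReal ω - W t.toNNReal ω := by
  filter_upwards [hW.cont] with ω h s
  simp [noise, contVersion, h]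

omit [IsProbabilityMeasure P] in
lemma noise_moments {W : ℝ≥0 → Ω → ℝ} (hW : IsBrownianReal W P) {t s : ℝ} (ht : 0 ≤ t)
    (hs : t ≤ s) : MemLp (noise W t s) 2 P ∧ ∫ ω, noise W t s ω ∂P = 0 ∧
      ∫ ω, noise W t s ω ^ 2 ∂P = s - t := by
  obtain ⟨v, hlaw, hvar⟩ : ∃ v : ℝ≥0, HasLaw (noise W t s) (gaussianReal 0 v) P ∧ v = s - t := by
    refine ⟨_, (hW.hasLaw_sub s.toNNReal t.toNNReal).congr ?_, ?_⟩
    · filter_upwards [noise_ae_eq hW t] with ω h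
      simp [h]
    · change |(s.toNNReal : ℝ) - (t.toNNReal : ℝ)| = s - t
      rw [Real.coe_toNNReal _ (ht.trans hs), Real.coe_toNNReal _ ht, abs_of_nonneg (by linarith)]
  have h0 : ∫ ω, noise W t s ω ∂P = 0 := by
    rw [hlaw.integral_eq, integral_id_gaussianReal]
  have hL : MemLp (noise W t s) 2 P := by
    have := memLp_id_gaussianReal' (μ := 0) (v := v) 2 (by simp)
    rw [← hlaw.map_eq] at this
    exact (memLp_map_measure_iff (by fun_prop) hlaw.aemeasurable).1 this
  refine ⟨hL, h0, ?_⟩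
  have hv := hlaw.variance_eq
  rw [variance_of_integral_eq_zero hlaw.aemeasurable h0, variance_id_gaussianReal] at hv
  rw [hv, hvar]

lemma memL2Prog_noise [P.IsComplete] {W : ℝ≥0 → Ω → ℝ} (hW : IsBrownianReal W P) {t T : ℝ}
    (ht : 0 ≤ t) (htT : t ≤ T) : MemL2Prog P (augFiltration W P hW) t T (noise W t) := by
  have hp : ProgressiveOn (augFiltration W P hW) t T (noise W t) := fun s hs =>
    measurable_uncurry_of_continuous_of_measurable (m := augFiltration W P hW s.toNNReal)
      (u := fun (r : Icc t s) ω => noise W t r ω)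
      (fun ω => (continuous_noise W t ω).comp continuous_subtype_val)
      (fun r => Measurable.sub
        (measurable_contVersion hW (Real.toNNReal_le_toNNReal r.2.2))
        (measurable_contVersion hW (Real.toNNReal_le_toNNReal hs.1)))
  have hm := hp.aestronglyMeasurable (P := P) htT
  refine ⟨hp, (memLp_two_iff_integrable_sq hm).2 ?_⟩
  refine (integrable_prod_iff (hm.pow 2)).2 ⟨?_, ?_⟩
  · filter_upwards [ae_restrict_mem measurableSet_Icc] with s hs
    exact (noise_moments hW ht hs.1).1.integrable_sq
  · refine Integrable.of_bound (hm.pow 2).norm.integral_prod_right' (T - t) ?_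
    filter_upwards [ae_restrict_mem measurableSet_Icc] with s hs
    have : ∫ ω, ‖(Function.uncurry (noise W t) ^ 2) (s, ω)‖ ∂P = s - t := by
      rw [← (noise_moments hW ht hs.1).2.2]
      exact integral_congr_ae (ae_of_all _ fun ω => Real.norm_of_nonneg (sq_nonneg _))
    rw [this, Real.norm_of_nonneg (by linarith [hs.1])]
    linarith [hs.2]

/-! ### The state equation -/

variable {ℱ : Filtration ℝ≥0 mΩ}

lemma MemL2Prog.mono {a a' b : ℝ} {u : ℝ → Ω → ℝ} (hu : MemL2Prog P ℱ a b u) (h : a ≤ a') :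
    MemL2Prog P ℱ a' b u :=
  ⟨hu.progressive.mono h, hu.memLp.mono_measure
    (Measure.prod_mono (Measure.restrict_mono (Icc_subset_Icc_left h) le_rfl) le_rfl)⟩

lemma MemL2Prog.volterraSol {a t T : ℝ} (htT : t ≤ T) {F : ℝ → Ω → ℝ}
    (hF : MemL2Prog P ℱ t T F) :
    MemL2Prog P ℱ t T (fun s ω => volterraSol a t (fun τ => F τ ω) s) := by
  have h1 := hF.mul_continuousOn (f := fun τ => Real.exp (-a * τ)) htT (by fun_prop)
  have h2 := (h1.primitive htT).mul_continuousOn (f := fun τ => Real.exp (a * τ)) htT (by fun_prop)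
  exact hF.add (h2.const_mul htT a)

/-- The resolvent of a centred process is centred. -/
lemma MemL2Prog.mean_volterraSol {a t T : ℝ} (htT : t ≤ T) {F : ℝ → Ω → ℝ}
    (hF : MemL2Prog P ℱ t T F) (hi : ∀ s ∈ Icc t T, Integrable (F s) P)
    (h0 : ∀ s ∈ Icc t T, ∫ ω, F s ω ∂P = 0) {s : ℝ} (hs : s ∈ Icc t T) :
    Integrable (fun ω => Advertising.volterraSol a t (fun τ => F τ ω) s) P ∧
      ∫ ω, Advertising.volterraSol a t (fun τ => F τ ω) s ∂P = 0 := by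
  have h1 := (hF.mul_continuousOn (f := fun τ => Real.exp (-a * τ)) htT
    (by fun_prop)).integral_primitive hs
  have h2 : ∫ τ in t..s, ∫ ω, Real.exp (-a * τ) * F τ ω ∂P = 0 := by
    rw [intervalIntegral.integral_congr (g := fun _ => (0 : ℝ)) fun τ hτ => ?_]
    · simp
    · rw [uIcc_of_le hs.1] at hτ
      simp only [integral_const_mul, h0 τ ⟨hτ.1, hτ.2.trans hs.2⟩, mul_zero]
  unfold Advertising.volterraSol
  have h3 := (h1.1.const_mul (Real.exp (a * s))).const_mul a
  refine ⟨(hi s hs).add h3, ?_⟩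
  rw [integral_add (hi s hs) h3, h0 s hs, integral_const_mul, integral_const_mul, h1.2, h2]
  simp

/-- The part of the drift which does not involve the state. -/
def Model.force (M : Model) (t : ℝ) (u : ℝ → Ω → ℝ) (s : ℝ) (ω : Ω) : ℝ :=
  M.b0 * u s ω + M.delay t u s ω

lemma Model.memL2Prog_force (M : Model) {t : ℝ} (ht : t ∈ Icc 0 M.T) {u : ℝ → Ω → ℝ}
    (hu : u ∈ M.controls P ℱ) : MemL2Prog P ℱ t M.T (M.force t u) :=
  ((MemL2Prog.mono hu ht.1).const_mul ht.2 M.b0).add (M.memL2Prog_delay ht.1 ht.2 hu)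

omit [IsProbabilityMeasure P] in
lemma Model.drift_eq (M : Model) {t s : ℝ} (u X : ℝ → Ω → ℝ) (hs : s ∈ Ioc t M.T) (ω : Ω) :
    M.drift P t u X s ω = M.a0 * X s ω + M.a1 * (∫ ω', X s ω' ∂P) + M.force t u s ω := by
  rw [Model.drift, M.delay_eq u ⟨hs.1.le, hs.2⟩, Model.force, Model.extend, if_neg (not_le.2 hs.1),
    add_assoc]

omit [IsProbabilityMeasure P] in
lemma Model.integral_drift (M : Model) {t s : ℝ} {u X : ℝ → Ω → ℝ} (hs : s ∈ Icc t M.T) {ω : Ω}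
    (hX : IntervalIntegrable (fun τ => X τ ω) volume t M.T)
    (hm : IntervalIntegrable (fun τ => ∫ ω', X τ ω' ∂P) volume t M.T)
    (hf : IntervalIntegrable (fun τ => M.force t u τ ω) volume t M.T) :
    ∫ τ in t..s, M.drift P t u X τ ω = M.a0 * (∫ τ in t..s, X τ ω) +
      M.a1 * (∫ τ in t..s, ∫ ω', X τ ω' ∂P) + ∫ τ in t..s, M.force t u τ ω := by
  have hsub : uIcc t s ⊆ uIcc t M.T := by
    rw [uIcc_of_le hs.1, uIcc_of_le (hs.1.trans hs.2)]; exact Icc_subset_Icc_right hs.2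
  rw [← intervalIntegral.integral_const_mul, ← intervalIntegral.integral_const_mul,
    ← intervalIntegral.integral_add ((hX.mono_set hsub).const_mul _)
      ((hm.mono_set hsub).const_mul _), ← intervalIntegral.integral_add
      (((hX.mono_set hsub).const_mul _).add ((hm.mono_set hsub).const_mul _)) (hf.mono_set hsub)]
  refine intervalIntegral.integral_congr_ae (ae_of_all _ fun τ hτ => ?_)
  rw [uIoc_of_le hs.1] at hτ
  exact M.drift_eq u X ⟨hτ.1, hτ.2.trans hs.2⟩ ω

lemma intervalIntegrable_mean {a b : ℝ} (hab : a ≤ b) {X : ℝ → Ω → ℝ}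
    (hX : MemL2Prog P ℱ a b X) : IntervalIntegrable (fun τ => ∫ ω', X τ ω' ∂P) volume a b :=
  (intervalIntegrable_iff_integrableOn_Icc_of_le hab).2
    ((memLp_mean hX.memLp).integrable one_le_two)

/-- The state equation in terms of the continuous version of the noise. -/
lemma Model.IsSolution.path_eq {M : Model} {W : ℝ≥0 → Ω → ℝ} (hW : IsBrownianReal W P) {t x : ℝ}
    (ht : t ∈ Icc 0 M.T) {u X : ℝ → Ω → ℝ} (hu : u ∈ M.controls P ℱ)
    (hX : M.IsSolution P ℱ W t x u X) : ∀ᵐ ω ∂P, ∀ s ∈ Icc t M.T,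
      X s ω = x + (M.a0 * (∫ τ in t..s, X τ ω) + M.a1 * (∫ τ in t..s, ∫ ω', X τ ω' ∂P) +
        ∫ τ in t..s, M.force t u τ ω) + M.σ * noise W t s ω := by
  filter_upwards [hX.equation, hX.memL2.slice ht.2, (M.memL2Prog_force ht hu).slice ht.2,
    noise_ae_eq hW t] with ω h1 h2 h3 h4 s hs
  rw [← M.integral_drift hs h2 (intervalIntegrable_mean ht.2 hX.memL2) h3, h4, ← h1 s hs]

/-- The mean of the state solves a scalar linear Volterra equation. -/
lemma Model.IsSolution.mean_eq {M : Model} {W : ℝ≥0 → Ω → ℝ} (hW : IsBrownianReal W P) {t x : ℝ}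
    (ht : t ∈ Icc 0 M.T) {u X : ℝ → Ω → ℝ} (hu : u ∈ M.controls P ℱ)
    (hX : M.IsSolution P ℱ W t x u X) {s : ℝ} (hs : s ∈ Icc t M.T) :
    Integrable (X s) P ∧ ∫ ω, X s ω ∂P = x + ((M.a0 + M.a1) * (∫ τ in t..s, ∫ ω', X τ ω' ∂P) +
        ∫ τ in t..s, ∫ ω, M.force t u τ ω ∂P) := by
  have hf := (M.memL2Prog_force ht hu).integral_primitive hs
  have hx := hX.memL2.integral_primitive hs
  have hn := noise_moments hW ht.1 hs.1
  have he : X s =ᵐ[P] fun ω => x + (M.a0 * (∫ τ in t..s, X τ ω) +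
      M.a1 * (∫ τ in t..s, ∫ ω', X τ ω' ∂P) + ∫ τ in t..s, M.force t u τ ω) +
        M.σ * noise W t s ω := by
    filter_upwards [hX.path_eq hW ht hu] with ω h using h s hs
  have i1 : Integrable (fun ω => M.a0 * (∫ τ in t..s, X τ ω)) P := hx.1.const_mul _
  have i2 : Integrable (fun _ : Ω => M.a1 * (∫ τ in t..s, ∫ ω', X τ ω' ∂P)) P :=
    integrable_const _
  have i3 := (hn.1.integrable one_le_two).const_mul M.σ
  have i12 : Integrable (fun ω => M.a0 * (∫ τ in t..s, X τ ω) +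
    M.a1 * (∫ τ in t..s, ∫ ω', X τ ω' ∂P)) P := i1.add i2
  have i4 : Integrable (fun ω => M.a0 * (∫ τ in t..s, X τ ω) +
    M.a1 * (∫ τ in t..s, ∫ ω', X τ ω' ∂P) + ∫ τ in t..s, M.force t u τ ω) P := i12.add hf.1
  have i5 : Integrable (fun ω => x + (M.a0 * (∫ τ in t..s, X τ ω) +
    M.a1 * (∫ τ in t..s, ∫ ω', X τ ω' ∂P) + ∫ τ in t..s, M.force t u τ ω)) P :=
    (integrable_const x).add i4
  refine ⟨(integrable_congr he).2 (i5.add i3), ?_⟩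
  rw [integral_congr_ae he, integral_add i5 i3, integral_add (integrable_const x) i4,
    integral_add i12 hf.1, integral_add i1 i2, integral_const_mul, integral_const_mul, hf.2, hx.2,
    integral_const_mul M.σ, hn.2.1]
  simp only [integral_const, probReal_univ, one_smul]
  ring

/-- Pathwise uniqueness. The means of two solutions agree, because they solve the same scalar
Volterra equation; the mean-field term then cancels in the difference of the solutions, which solves
a Volterra equation path by path. -/
lemma Model.IsSolution.unique {M : Model} {W : ℝ≥0 → Ω → ℝ} (hW : IsBrownianReal W P) {t x : ℝ}
    (ht : t ∈ Icc 0 M.T) {u X Y : ℝ → Ω → ℝ} (hu : u ∈ M.controls P ℱ)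
    (hX : M.IsSolution P ℱ W t x u X) (hY : M.IsSolution P ℱ W t x u Y) :
    ∀ᵐ ω ∂P, ∀ s ∈ Icc t M.T, X s ω = Y s ω := by
  have hsub : ∀ s ∈ Icc t M.T, uIcc t s ⊆ uIcc t M.T := fun s hs => by
    rw [uIcc_of_le hs.1, uIcc_of_le (hs.1.trans hs.2)]; exact Icc_subset_Icc_right hs.2
  have hmX := intervalIntegrable_mean ht.2 hX.memL2
  have hmY := intervalIntegrable_mean ht.2 hY.memL2
  -- the means agree
  have hm : ∀ s ∈ Icc t M.T, ∫ ω, X s ω ∂P = ∫ ω, Y s ω ∂P := fun s hs => by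
    refine sub_eq_zero.1
      (eq_zero_of_volterra (a := M.a0 + M.a1) (hmX.sub hmY) (fun s hs => ?_) s hs)
    rw [intervalIntegral.integral_sub (hmX.mono_set (hsub s hs)) (hmY.mono_set (hsub s hs)),
      (hX.mean_eq hW ht hu hs).2, (hY.mean_eq hW ht hu hs).2]
    ring
  filter_upwards [hX.path_eq hW ht hu, hY.path_eq hW ht hu, hX.memL2.slice ht.2,
    hY.memL2.slice ht.2] with ω h1 h2 h3 h4 s hs
  refine sub_eq_zero.1 (eq_zero_of_volterra (a := M.a0) (h3.sub h4) (fun s hs => ?_) s hs)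
  have h5 : ∫ τ in t..s, ∫ ω', X τ ω' ∂P = ∫ τ in t..s, ∫ ω', Y τ ω' ∂P :=
    intervalIntegral.integral_congr fun τ hτ => by
      rw [uIcc_of_le hs.1] at hτ
      exact hm τ ⟨hτ.1, hτ.2.trans hs.2⟩
  rw [intervalIntegral.integral_sub (h3.mono_set (hsub s hs)) (h4.mono_set (hsub s hs)),
    h1 s hs, h2 s hs, h5]
  ring

/-- Existence. The centred forcing is propagated at rate `a₀` and its mean at rate `a₀ + a₁`; the
sum of the two solves the mean-field equation because the first part stays centred. -/
lemma Model.exists_isSolution [P.IsComplete] (M : Model) {W : ℝ≥0 → Ω → ℝ}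
    (hW : IsBrownianReal W P) {t : ℝ} (x : ℝ) (ht : t ∈ Icc 0 M.T) {u : ℝ → Ω → ℝ}
    (hu : u ∈ M.controls P (augFiltration W P hW)) :
    ∃ X, M.IsSolution P (augFiltration W P hW) W t x u X := by
  have htT := ht.2
  have hF := M.memL2Prog_force ht hu
  have hN := memL2Prog_noise hW ht.1 htT
  -- the mean of the forcing term, and the centred forcing term
  set k : ℝ → ℝ := fun s => x + ∫ τ in t..s, ∫ ω, M.force t u τ ω ∂P with hk
  set Y : ℝ → Ω → ℝ := fun s ω => (∫ τ in t..s, M.force t u τ ω) + M.σ * noise W t s ω +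
    (x - k s) with hYdef
  have hkc : ContinuousOn k (Icc t M.T) := by
    have h2 := intervalIntegral.continuousOn_primitive_interval
      (f := fun s => ∫ ω, M.force t u s ω ∂P) (μ := volume) (a := t) (b := M.T) (by
        rw [uIcc_of_le htT]
        exact (intervalIntegrable_iff_integrableOn_Icc_of_le htT).1
          (intervalIntegrable_mean htT hF))
    rw [uIcc_of_le htT] at h2
    exact continuousOn_const.add h2
  have hY : MemL2Prog P (augFiltration W P hW) t M.T Y :=
    ((hF.primitive htT).add (hN.const_mul htT M.σ)).add
      (.of_continuousOn (f := fun s => x - k s) (continuousOn_const.sub hkc))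
  have hYc : ∀ᵐ ω ∂P, ContinuousOn (fun s => Y s ω) (Icc t M.T) := by
    filter_upwards [hF.continuousOn_primitive htT] with ω h
    exact (h.add (continuousOn_const.mul (continuous_noise W t ω).continuousOn)).add
      (continuousOn_const.sub hkc)
  have hYm : ∀ s ∈ Icc t M.T, Integrable (Y s) P ∧ ∫ ω, Y s ω ∂P = 0 := fun s hs => by
    have h1 := hF.integral_primitive hs
    have h2 := noise_moments hW ht.1 hs.1
    have i2 := (h2.1.integrable one_le_two).const_mul M.σ
    have i12 : Integrable (fun ω => (∫ τ in t..s, M.force t u τ ω) + M.σ * noise W t s ω) P :=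
      h1.1.add i2
    refine ⟨i12.add (integrable_const _), ?_⟩
    simp only [hYdef]
    rw [integral_add i12 (integrable_const _), integral_add h1.1 i2, integral_const_mul, h1.2,
      h2.2.1]
    simp [hk]
  set X : ℝ → Ω → ℝ := fun s ω => volterraSol M.a0 t (fun τ => Y τ ω) s +
    volterraSol (M.a0 + M.a1) t k s with hX
  have hkS := continuousOn_volterraSol (a := M.a0 + M.a1) htT hkc
  have hXL : MemL2Prog P (augFiltration W P hW) t M.T X :=
    (hY.volterraSol htT).add (.of_continuousOn hkS)
  have hXm : ∀ s ∈ Icc t M.T, ∫ ω, X s ω ∂P = volterraSol (M.a0 + M.a1) t k s := fun s hs => by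
    have h := hY.mean_volterraSol (a := M.a0) htT (fun s hs => (hYm s hs).1)
      (fun s hs => (hYm s hs).2) hs
    simp only [hX]
    rw [integral_add h.1 (integrable_const _), h.2]
    simp
  refine ⟨X, hXL, ?_, ?_⟩
  · filter_upwards [hYc] with ω h
    exact (continuousOn_volterraSol htT h).add hkS
  · filter_upwards [hYc, noise_ae_eq hW t, hF.slice htT, hXL.slice htT] with ω hc hn hf hXi s hs
    rw [M.integral_drift hs hXi (intervalIntegrable_mean htT hXL) hf, ← hn s]
    have hsub : uIcc t s ⊆ Icc t M.T := by
      rw [uIcc_of_le hs.1]; exact Icc_subset_Icc_right hs.2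
    have e1 : ∫ τ in t..s, X τ ω = (∫ τ in t..s, volterraSol M.a0 t (fun τ => Y τ ω) τ) +
        ∫ τ in t..s, volterraSol (M.a0 + M.a1) t k τ :=
      intervalIntegral.integral_add
        ((continuousOn_volterraSol htT hc).mono hsub).intervalIntegrable
        (hkS.mono hsub).intervalIntegrable
    have e2 : ∫ τ in t..s, ∫ ω', X τ ω' ∂P = ∫ τ in t..s, volterraSol (M.a0 + M.a1) t k τ :=
      intervalIntegral.integral_congr fun τ hτ => hXm τ (hsub hτ)
    rw [e1, e2]
    simp only [hX]
    rw [volterraSol_eq hc hs, volterraSol_eq hkc hs]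
    simp only [hYdef]
    ring

lemma Model.isSolution_state [P.IsComplete] (M : Model) {W : ℝ≥0 → Ω → ℝ}
    (hW : IsBrownianReal W P) {t : ℝ} (x : ℝ) (ht : t ∈ Icc 0 M.T) {u : ℝ → Ω → ℝ}
    (hu : u ∈ M.controls P (augFiltration W P hW)) :
    M.IsSolution P (augFiltration W P hW) W t x u
      (M.state P (augFiltration W P hW) W t x u) := by
  have h := M.exists_isSolution hW x ht hu
  rw [Model.state, dif_pos h]
  exact h.choose_spec

end Stochastic

/-! ### The costate and duality -/

/-- The scalar costate, solution of `A' = -(a₀ + a₁ - r) A - (α₀ - α₁)`, `A(T) = λ₀ - λ₁`. -/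
def Model.costate (M : Model) (Q : LQ) (s : ℝ) : ℝ :=
  Real.exp (-((M.a0 + M.a1 - M.r) * s)) *
    (Real.exp ((M.a0 + M.a1 - M.r) * M.T) * (Q.lam0 - Q.lam1) +
      (Q.α0 - Q.α1) * ∫ ρ in s..M.T, Real.exp ((M.a0 + M.a1 - M.r) * ρ))

lemma Model.hasDerivAt_costate (M : Model) (Q : LQ) (s : ℝ) :
    HasDerivAt (M.costate Q)
      (-(M.a0 + M.a1 - M.r) * M.costate Q s - (Q.α0 - Q.α1)) s := by
  set κ := M.a0 + M.a1 - M.r with hκ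
  have h1 : HasDerivAt (fun s => Real.exp (-(κ * s))) (Real.exp (-(κ * s)) * -(κ * 1)) s :=
    ((hasDerivAt_id s).const_mul κ).neg.exp
  have hc : Continuous fun ρ => Real.exp (κ * ρ) := by fun_prop
  have h2 : HasDerivAt (fun s => ∫ ρ in s..M.T, Real.exp (κ * ρ)) (-Real.exp (κ * s)) s :=
    intervalIntegral.integral_hasDerivAt_left (hc.intervalIntegrable _ _)
      hc.stronglyMeasurable.stronglyMeasurableAtFilter hc.continuousAt
  have h3 := h1.mul ((h2.const_mul (Q.α0 - Q.α1)).const_add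
    (Real.exp (κ * M.T) * (Q.lam0 - Q.lam1)))
  refine h3.congr_deriv ?_
  have : Real.exp (-(κ * s)) * Real.exp (κ * s) = 1 := by rw [← Real.exp_add]; simp
  unfold Model.costate
  rw [← hκ]
  linear_combination -(Q.α0 - Q.α1) * this

lemma Model.continuous_costate (M : Model) (Q : LQ) : Continuous (M.costate Q) :=
  continuous_iff_continuousAt.2 fun s => (M.hasDerivAt_costate Q s).continuousAt

lemma Model.costate_T (M : Model) (Q : LQ) : M.costate Q M.T = Q.lam0 - Q.lam1 := by
  unfold Model.costate
  rw [intervalIntegral.integral_same, mul_zero, add_zero, ← mul_assoc, ← Real.exp_add]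
  simp

/-- The discounted costate `e^{-r(s-t)} A(s)`. -/
def Model.dcostate (M : Model) (Q : LQ) (t s : ℝ) : ℝ :=
  Real.exp (-M.r * (s - t)) * M.costate Q s

lemma Model.continuous_dcostate (M : Model) (Q : LQ) (t : ℝ) : Continuous (M.dcostate Q t) :=
  (by fun_prop : Continuous fun s => Real.exp (-M.r * (s - t))).mul (M.continuous_costate Q)

lemma Model.hasDerivAt_dcostate (M : Model) (Q : LQ) (t s : ℝ) :
    HasDerivAt (M.dcostate Q t) (-(M.a0 + M.a1) * M.dcostate Q t s -
      Real.exp (-M.r * (s - t)) * (Q.α0 - Q.α1)) s := by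
  have h1 : HasDerivAt (fun s => Real.exp (-M.r * (s - t)))
      (Real.exp (-M.r * (s - t)) * (-M.r * 1)) s :=
    (((hasDerivAt_id s).sub_const t).const_mul (-M.r)).exp
  refine (h1.mul (M.hasDerivAt_costate Q s)).congr_deriv ?_
  unfold Model.dcostate
  ring

/-- Duality between the mean state equation and the costate equation: the part of the reward
which is linear in the mean state is a linear functional of the forcing term. -/
lemma Model.duality (M : Model) (Q : LQ) {t x : ℝ} (htT : t ≤ M.T) {m φ : ℝ → ℝ}
    (hm : IntervalIntegrable m volume t M.T) (hφ : IntervalIntegrable φ volume t M.T)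
    (heq : ∀ s ∈ Icc t M.T,
      m s = x + ((M.a0 + M.a1) * (∫ τ in t..s, m τ) + ∫ τ in t..s, φ τ)) :
    (∫ s in t..M.T, Real.exp (-M.r * (s - t)) * ((Q.α0 - Q.α1) * m s)) +
      Real.exp (-M.r * (M.T - t)) * ((Q.lam0 - Q.lam1) * m M.T) =
      M.dcostate Q t t * x + ∫ s in t..M.T, M.dcostate Q t s * φ s := by
  set c := M.a0 + M.a1 with hc
  set p := M.dcostate Q t with hp
  set p' : ℝ → ℝ := fun s => -c * p s - Real.exp (-M.r * (s - t)) * (Q.α0 - Q.α1) with hp'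
  have hpc : Continuous p := M.continuous_dcostate Q t
  have hpc' : Continuous p' := by fun_prop
  have hpd : ∀ s, HasDerivAt p (p' s) s := M.hasDerivAt_dcostate Q t
  have hg : IntervalIntegrable (fun s => c * m s + φ s) volume t M.T := (hm.const_mul c).add hφ
  have hF : ∀ s ∈ Icc t M.T, ∫ τ in t..s, (c * m τ + φ τ) = m s - x := fun s hs => by
    have hsub : uIcc t s ⊆ uIcc t M.T := by
      rw [uIcc_of_le hs.1, uIcc_of_le htT]; exact Icc_subset_Icc_right hs.2
    rw [intervalIntegral.integral_add ((hm.mono_set hsub).const_mul c) (hφ.mono_set hsub),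
      intervalIntegral.integral_const_mul, heq s hs]
    ring
  have h1 := integral_deriv_mul_primitive hpd hpc' hg
  rw [hF M.T ⟨htT, le_rfl⟩, intervalIntegral.integral_congr (g := fun s => p' s * (m s - x))
    (fun s hs => by rw [uIcc_of_le htT] at hs; simp only [hF s hs])] at h1
  have ip'm : IntervalIntegrable (fun s => p' s * m s) volume t M.T :=
    hm.continuousOn_mul hpc'.continuousOn
  have ipm : IntervalIntegrable (fun s => p s * m s) volume t M.T :=
    hm.continuousOn_mul hpc.continuousOn
  have ipφ : IntervalIntegrable (fun s => p s * φ s) volume t M.T :=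
    hφ.continuousOn_mul hpc.continuousOn
  have ip'x : IntervalIntegrable (fun s => p' s * x) volume t M.T :=
    (hpc'.mul continuous_const).intervalIntegrable _ _
  have inp'm : IntervalIntegrable (fun s => -(p' s * m s)) volume t M.T := ip'm.neg
  have h2 : ∫ s in t..M.T, p' s * (m s - x) =
      (∫ s in t..M.T, p' s * m s) - (p M.T - p t) * x := by
    rw [← intervalIntegral.integral_eq_sub_of_hasDerivAt (fun s _ => hpd s)
      (hpc'.intervalIntegrable _ _), ← intervalIntegral.integral_mul_const,
      ← intervalIntegral.integral_sub ip'm ip'x]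
    simp only [mul_sub]
  have h3 : ∫ s in t..M.T, p s * (c * m s + φ s) =
      c * (∫ s in t..M.T, p s * m s) + ∫ s in t..M.T, p s * φ s := by
    rw [← intervalIntegral.integral_const_mul,
      ← intervalIntegral.integral_add (ipm.const_mul c) ipφ]
    congr 1; ext s; ring
  have h4 : ∫ s in t..M.T, Real.exp (-M.r * (s - t)) * ((Q.α0 - Q.α1) * m s) =
      -(∫ s in t..M.T, p' s * m s) - c * ∫ s in t..M.T, p s * m s := by
    rw [← intervalIntegral.integral_const_mul, ← intervalIntegral.integral_neg,
      ← intervalIntegral.integral_sub inp'm (ipm.const_mul c)]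
    congr 1; ext s; simp only [hp']; ring
  have hpT : p M.T = Real.exp (-M.r * (M.T - t)) * (Q.lam0 - Q.lam1) := by
    rw [hp, Model.dcostate, M.costate_T]
  rw [h4]
  rw [h2, h3] at h1
  linear_combination -h1 - m M.T * hpT

/-! ### The reward as a functional of the control -/

/-- The marginal value `⟨B* a(s), (1,1)⟩` of the control at time `s`, in terms of the scalar
costate: `b₀ A(s) + ∫ b₁(ξ) e^{rξ} A(s - ξ) 1_{s - ξ ≤ T} dξ`. The lower cut-off of the indicator of
`[0, T]` is void for `s ∈ [0, T]` and `ξ ≤ 0`; it keeps the integrand bounded for all `s`. -/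
def Model.marginal (M : Model) (Q : LQ) (s : ℝ) : ℝ :=
  M.b0 * M.costate Q s +
    ∫ ξ, M.kern ξ * (Real.exp (M.r * ξ) * (Icc 0 M.T).indicator (M.costate Q) (s - ξ))

lemma Model.measurable_marginal (M : Model) (Q : LQ) : Measurable (M.marginal Q) := by
  refine ((M.continuous_costate Q).measurable.const_mul _).add ?_
  refine (StronglyMeasurable.integral_prod_right (ν := volume) (f := fun s ξ => M.kern ξ *
    (Real.exp (M.r * ξ) * (Icc 0 M.T).indicator (M.costate Q) (s - ξ))) ?_).measurable
  refine Measurable.stronglyMeasurable ?_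
  have h := (M.continuous_costate Q).measurable.indicator (measurableSet_Icc (a := 0) (b := M.T))
  exact (M.kern_spec.1.comp measurable_snd).mul
    (Measurable.mul (by fun_prop) (h.comp (measurable_fst.sub measurable_snd)))

lemma Model.exists_marginal_bound (M : Model) (Q : LQ) :
    ∃ C, ∀ s ∈ Icc 0 M.T, ‖M.marginal Q s‖ ≤ C := by
  obtain ⟨C, hC⟩ := isCompact_Icc.exists_bound_of_continuousOn
    (M.continuous_costate Q).continuousOn (s := Icc 0 M.T)
  obtain ⟨D, hD⟩ := isCompact_Icc.exists_bound_of_continuousOn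
    (s := Icc (-M.d) 0) (by fun_prop : Continuous fun ξ => Real.exp (M.r * ξ)).continuousOn
  refine ⟨‖M.b0‖ * C + ∫ ξ, ‖M.kern ξ‖ * (D * C), fun s hs => ?_⟩
  have hC0 : 0 ≤ C := (norm_nonneg _).trans (hC s hs)
  refine (norm_add_le _ _).trans (add_le_add ?_ ?_)
  · rw [norm_mul]
    exact mul_le_mul_of_nonneg_left (hC s hs) (norm_nonneg _)
  · refine norm_integral_le_of_norm_le (M.kern_spec.2.2.1.norm.mul_const _)
      (ae_of_all _ fun ξ => ?_)
    rw [norm_mul, norm_mul]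
    by_cases hξ : ξ ∈ Icc (-M.d) 0
    · refine mul_le_mul_of_nonneg_left (mul_le_mul (hD ξ hξ) ?_ (norm_nonneg _)
        ((norm_nonneg _).trans (hD ξ hξ))) (norm_nonneg _)
      by_cases h : s - ξ ∈ Icc 0 M.T
      · rw [indicator_of_mem h]; exact hC _ h
      · rw [indicator_of_notMem h, norm_zero]; exact hC0
    · simp [M.kern_spec.2.2.2.1 ξ hξ]

section Stochastic

variable {Ω : Type*} {mΩ : MeasurableSpace Ω} {P : Measure Ω} [IsProbabilityMeasure P]
  {ℱ : Filtration ℝ≥0 mΩ}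

/-- The discounted costate, paired with `B`, is the discounted marginal value. -/
lemma Model.convolution_dcostate (M : Model) (Q : LQ) {t v : ℝ} (ht : 0 ≤ t)
    (hv : v ∈ Ioc t M.T) :
    M.b0 * M.dcostate Q t v + ∫ ξ, M.kern ξ * (Ioc t M.T).indicator (M.dcostate Q t) (v - ξ) =
      Real.exp (-M.r * (v - t)) * M.marginal Q v := by
  rw [Model.marginal, mul_add, ← integral_const_mul]
  congr 1
  · unfold Model.dcostate; ring
  · congr 1
    ext ξ
    by_cases hξ : ξ ∈ Icc (-M.d) 0
    · have h0 : t < v - ξ := by linarith [hv.1, hξ.2]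
      by_cases h : v - ξ ≤ M.T
      · rw [indicator_of_mem (mem_Ioc.2 ⟨h0, h⟩), indicator_of_mem (mem_Icc.2 ⟨by linarith, h⟩),
          Model.dcostate]
        have : Real.exp (-M.r * (v - ξ - t)) =
            Real.exp (-M.r * (v - t)) * Real.exp (M.r * ξ) := by
          rw [← Real.exp_add]; congr 1; ring
        rw [this]; ring
      · rw [indicator_of_notMem (fun h' => h h'.2), indicator_of_notMem (fun h' => h h'.2)]
        ring
    · simp [M.kern_spec.2.2.2.1 ξ hξ]

/-- The constant part of the reward: contributions of the initial state and of the past control. -/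
def Model.baseReward (M : Model) (Q : LQ) (t x : ℝ) : ℝ :=
  M.dcostate Q t t * x + ∫ v, M.past (v - t) *
    ∫ ξ, M.kern ξ * (Ioc t M.T).indicator (M.dcostate Q t) (v - ξ)

/-- The forcing term tested against the costate is the mean control tested against the marginal
value, up to the contribution of the past control. -/
lemma Model.integral_dcostate_force (M : Model) (Q : LQ) {t : ℝ} (x : ℝ) (ht : t ∈ Icc 0 M.T)
    {u : ℝ → Ω → ℝ} (hu : u ∈ M.controls P ℱ) :
    M.dcostate Q t t * x + ∫ s in t..M.T, M.dcostate Q t s * ∫ ω, M.force t u s ω ∂P =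
      M.baseReward Q t x + ∫ s in t..M.T, Real.exp (-M.r * (s - t)) *
        (M.marginal Q s * ∫ ω, u s ω ∂P) := by
  have htT := ht.2
  have hut := MemL2Prog.mono hu ht.1
  have hdel := M.memL2Prog_delay ht.1 ht.2 hu
  set p := M.dcostate Q t with hp
  have hpc : Continuous p := M.continuous_dcostate Q t
  set ph := (Ioc t M.T).indicator p with hph
  set V := (Ioc t M.T).indicator (fun τ => ∫ ω, u τ ω ∂P) with hV
  have hubar : IntegrableOn (fun τ => ∫ ω, u τ ω ∂P) (Ioc t M.T) :=
    ((memLp_mean hut.memLp).integrable one_le_two).mono_measure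
      (Measure.restrict_mono Ioc_subset_Icc_self le_rfl)
  have hVi : Integrable V := (integrable_indicator_iff measurableSet_Ioc).2 hubar
  have hpm : Measurable ph := hpc.measurable.indicator measurableSet_Ioc
  obtain ⟨C, hC⟩ := isCompact_Icc.exists_bound_of_continuousOn hpc.continuousOn (s := Icc t M.T)
  have hphC : ∀ s, |ph s| ≤ C := fun s => by
    by_cases h : s ∈ Ioc t M.T
    · rw [hph, indicator_of_mem h]; exact hC s ⟨h.1.le, h.2⟩
    · rw [hph, indicator_of_notMem h, abs_zero]
      exact (norm_nonneg _).trans (hC t ⟨le_rfl, htT⟩)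
  have hpast : Integrable fun v => M.past (v - t) := M.past_spec.2.2.1.comp_sub_right t
  obtain ⟨j1, -⟩ := integral_mul_convolution M.kern_spec.2.2.1 hpast hpm hphC
  obtain ⟨j2, -⟩ := integral_mul_convolution M.kern_spec.2.2.1 hVi hpm hphC
  obtain ⟨-, e3⟩ := integral_mul_convolution M.kern_spec.2.2.1 (hpast.add hVi) hpm hphC
  -- the delayed part
  have hd : ∫ s in t..M.T, p s * ∫ ω, M.delay t u s ω ∂P =
      (∫ v, M.past (v - t) * ∫ ξ, M.kern ξ * ph (v - ξ)) +
        ∫ s in t..M.T, (∫ ω, u s ω ∂P) * ∫ ξ, M.kern ξ * ph (s - ξ) := by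
    have e1 : ∫ s in t..M.T, p s * ∫ ω, M.delay t u s ω ∂P =
        ∫ τ, ph τ * ∫ ξ, M.kern ξ * ((fun v => M.past (v - t)) + V) (τ + ξ) := by
      rw [intervalIntegral.integral_of_le htT, ← integral_indicator measurableSet_Ioc]
      congr 1; ext τ
      by_cases h : τ ∈ Ioc t M.T
      · rw [indicator_of_mem h, hph, indicator_of_mem h, M.mean_delay ht.1 hu.memLp]
        rfl
      · rw [indicator_of_notMem h, hph, indicator_of_notMem h, zero_mul]
    rw [e1, e3]
    simp only [Pi.add_apply, add_mul]
    rw [integral_add j1 j2]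
    congr 1
    rw [intervalIntegral.integral_of_le htT, ← integral_indicator measurableSet_Ioc]
    congr 1; ext v
    by_cases h : v ∈ Ioc t M.T
    · rw [indicator_of_mem h, hV, indicator_of_mem h]
    · rw [indicator_of_notMem h, hV, indicator_of_notMem h, zero_mul]
  have iu : IntervalIntegrable (fun s => ∫ ω, u s ω ∂P) volume t M.T :=
    intervalIntegrable_mean htT hut
  have idel : IntervalIntegrable (fun s => p s * ∫ ω, M.delay t u s ω ∂P) volume t M.T :=
    (intervalIntegrable_mean htT hdel).continuousOn_mul hpc.continuousOn
  have ipu : IntervalIntegrable (fun s => M.b0 * (p s * ∫ ω, u s ω ∂P)) volume t M.T :=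
    (iu.continuousOn_mul hpc.continuousOn).const_mul _
  have hf : ∫ s in t..M.T, p s * ∫ ω, M.force t u s ω ∂P =
      (∫ s in t..M.T, M.b0 * (p s * ∫ ω, u s ω ∂P)) +
        ∫ s in t..M.T, p s * ∫ ω, M.delay t u s ω ∂P := by
    rw [← intervalIntegral.integral_add ipu idel]
    refine intervalIntegral.integral_congr_ae ?_
    have h1 := (ae_restrict_iff' measurableSet_Icc).1 (memLp_slice_left hut.memLp)
    have h2 := (ae_restrict_iff' measurableSet_Icc).1 (memLp_slice_left hdel.memLp)
    filter_upwards [h1, h2] with s h1 h2 hs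
    rw [uIoc_of_le htT] at hs
    have hs' : s ∈ Icc t M.T := ⟨hs.1.le, hs.2⟩
    unfold Model.force
    rw [integral_add (((h1 hs').integrable one_le_two).const_mul _)
      ((h2 hs').integrable one_le_two), integral_const_mul]
    ring
  have iuk : IntervalIntegrable
      (fun s => (∫ ω, u s ω ∂P) * ∫ ξ, M.kern ξ * ph (s - ξ)) volume t M.T := by
    rw [intervalIntegrable_iff_integrableOn_Ioc_of_le htT]
    refine (j2.integrableOn (s := Ioc t M.T)).congr_fun (fun s hs => ?_) measurableSet_Ioc
    simp only [hV, indicator_of_mem hs]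
  rw [hf, hd, Model.baseReward, ← hp, ← hph, add_left_comm (∫ s in t..M.T, _), ← add_assoc,
    ← intervalIntegral.integral_add ipu iuk]
  congr 1
  refine intervalIntegral.integral_congr_ae (ae_of_all _ fun s hs => ?_)
  rw [uIoc_of_le htT] at hs
  have := M.convolution_dcostate Q ht.1 hs
  rw [← hp, ← hph] at this
  linear_combination (∫ ω, u s ω ∂P) * this

/-- The discounted running reward of the control, after elimination of the state. -/
def Model.running (M : Model) (Q : LQ) (P : Measure Ω) (t : ℝ) (u : ℝ → Ω → ℝ) (s : ℝ) : ℝ :=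
  Real.exp (-M.r * (s - t)) * ((M.marginal Q s - (Q.β0 + Q.β1)) * (∫ ω, u s ω ∂P) -
    Q.γ0 * (∫ ω, u s ω ^ 2 ∂P) - Q.γ1 * (∫ ω, u s ω ∂P) ^ 2)

lemma intervalIntegrable_sq_mean {a b : ℝ} (hab : a ≤ b) {X : ℝ → Ω → ℝ}
    (hX : MemL2Prog P ℱ a b X) :
    IntervalIntegrable (fun τ => (∫ ω', X τ ω' ∂P) ^ 2) volume a b :=
  (intervalIntegrable_iff_integrableOn_Icc_of_le hab).2 (memLp_mean hX.memLp).integrable_sq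

lemma intervalIntegrable_mean_sq {a b : ℝ} (hab : a ≤ b) {X : ℝ → Ω → ℝ}
    (hX : MemL2Prog P ℱ a b X) :
    IntervalIntegrable (fun τ => ∫ ω', X τ ω' ^ 2 ∂P) volume a b :=
  (intervalIntegrable_iff_integrableOn_Icc_of_le hab).2 hX.memLp.integrable_sq.integral_prod_left

lemma Model.intervalIntegrable_running (M : Model) (Q : LQ) {t : ℝ} (ht : t ∈ Icc 0 M.T)
    {u : ℝ → Ω → ℝ} (hu : u ∈ M.controls P ℱ) :
    IntervalIntegrable (M.running Q P t u) volume t M.T := by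
  have hut := MemL2Prog.mono hu ht.1
  obtain ⟨C, hC⟩ := M.exists_marginal_bound Q
  have h1 : IntervalIntegrable (fun s => (M.marginal Q s - (Q.β0 + Q.β1)) * ∫ ω, u s ω ∂P)
      volume t M.T := by
    refine (intervalIntegrable_iff_integrableOn_Icc_of_le ht.2).2 ?_
    refine Integrable.bdd_mul (c := C + ‖Q.β0 + Q.β1‖)
      ((memLp_mean hut.memLp).integrable one_le_two)
      ((M.measurable_marginal Q).sub_const _).aestronglyMeasurable ?_
    filter_upwards [ae_restrict_mem measurableSet_Icc] with s hs
    exact (norm_sub_le _ _).trans (by gcongr; exact hC s ⟨ht.1.trans hs.1, hs.2⟩)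
  exact ((h1.sub ((intervalIntegrable_mean_sq ht.2 hut).const_mul Q.γ0)).sub
    ((intervalIntegrable_sq_mean ht.2 hut).const_mul Q.γ1)).continuousOn_mul
      (g := fun s => Real.exp (-M.r * (s - t))) (by fun_prop)

/-- The objective in terms of the mean state and the first two moments of the control. -/
lemma Model.J_eq_of_isSolution (M : Model) (Q : LQ) {W : ℝ≥0 → Ω → ℝ} (hW : IsBrownianReal W P)
    {t x : ℝ} (ht : t ∈ Icc 0 M.T) {u X : ℝ → Ω → ℝ} (hu : u ∈ M.controls P ℱ)
    (hX : M.IsSolution P ℱ W t x u X) :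
    ∫ ω, ((∫ s in t..M.T, Real.exp (-M.r * (s - t)) *
      Q.f s (X s ω) (∫ ω', X s ω' ∂P) (u s ω) (∫ ω', u s ω' ∂P)) +
    Real.exp (-M.r * (M.T - t)) * ∫ ω', Q.g (X M.T ω') (∫ ω'', X M.T ω'' ∂P) ∂P) ∂P =
    (∫ s in t..M.T, Real.exp (-M.r * (s - t)) * ((Q.α0 - Q.α1) * (∫ ω, X s ω ∂P) -
      (Q.β0 + Q.β1) * (∫ ω, u s ω ∂P) - Q.γ0 * (∫ ω, u s ω ^ 2 ∂P) -
      Q.γ1 * (∫ ω, u s ω ∂P) ^ 2)) +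
    Real.exp (-M.r * (M.T - t)) * ((Q.lam0 - Q.lam1) * ∫ ω, X M.T ω ∂P) := by
  have htT := ht.2
  have hut := MemL2Prog.mono hu ht.1
  set ν := volume.restrict (Icc t M.T) with hν
  have hXi : Integrable (fun q : ℝ × Ω => X q.1 q.2) (ν.prod P) := hX.memL2.integrable
  have hui : Integrable (fun q : ℝ × Ω => u q.1 q.2) (ν.prod P) := hut.integrable
  have hu2 : Integrable (fun q : ℝ × Ω => u q.1 q.2 ^ 2) (ν.prod P) := hut.memLp.integrable_sq
  have hmX : Integrable (fun q : ℝ × Ω => ∫ ω, X q.1 ω ∂P) (ν.prod P) :=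
    ((memLp_mean hX.memL2.memLp).integrable one_le_two).comp_fst P
  have hmu : Integrable (fun q : ℝ × Ω => ∫ ω, u q.1 ω ∂P) (ν.prod P) :=
    ((memLp_mean hut.memLp).integrable one_le_two).comp_fst P
  have hmu2 : Integrable (fun q : ℝ × Ω => (∫ ω, u q.1 ω ∂P) ^ 2) (ν.prod P) :=
    (memLp_mean hut.memLp).integrable_sq.comp_fst P
  have hfi : Integrable (fun q : ℝ × Ω =>
      Q.f q.1 (X q.1 q.2) (∫ ω', X q.1 ω' ∂P) (u q.1 q.2) (∫ ω', u q.1 ω' ∂P)) (ν.prod P) :=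
    (((((hXi.const_mul _).sub (hmX.const_mul _)).sub (hui.const_mul _)).sub
      (hu2.const_mul _)).sub (hmu.const_mul _)).sub (hmu2.const_mul _)
  obtain ⟨C, hC⟩ := isCompact_Icc.exists_bound_of_continuousOn (s := Icc t M.T)
    (by fun_prop : Continuous fun s => Real.exp (-M.r * (s - t))).continuousOn
  have hGi : Integrable (Function.uncurry fun s ω => Real.exp (-M.r * (s - t)) *
      Q.f s (X s ω) (∫ ω', X s ω' ∂P) (u s ω) (∫ ω', u s ω' ∂P)) (ν.prod P) := by
    refine hfi.bdd_mul (c := C) (f := fun q : ℝ × Ω => Real.exp (-M.r * (q.1 - t)))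
      (Measurable.aestronglyMeasurable (by fun_prop)) ?_
    have h3 : ∀ᵐ q ∂(ν.prod P), q.1 ∈ Icc t M.T :=
      Measure.quasiMeasurePreserving_fst.ae (ae_restrict_mem measurableSet_Icc)
    filter_upwards [h3] with q hq using hC _ hq
  have hgX := (hX.mean_eq hW ht hu ⟨htT, le_rfl⟩).1
  have hterm : ∫ ω', Q.g (X M.T ω') (∫ ω'', X M.T ω'' ∂P) ∂P =
      (Q.lam0 - Q.lam1) * ∫ ω, X M.T ω ∂P := by
    unfold LQ.g
    rw [integral_sub (hgX.const_mul _) (integrable_const _), integral_const_mul]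
    simp only [integral_const, probReal_univ, one_smul]
    ring
  have hI : ∀ φ : ℝ → ℝ, ∫ s in t..M.T, φ s = ∫ s, φ s ∂ν := fun φ => by
    rw [intervalIntegral.integral_of_le htT, hν, integral_Icc_eq_integral_Ioc]
  rw [hterm]
  simp only [hI]
  rw [integral_add (by exact hGi.integral_prod_right) (integrable_const _),
    ← integral_integral_swap hGi]
  congr 1
  · refine integral_congr_ae ?_
    filter_upwards [memLp_slice_left hX.memL2.memLp, memLp_slice_left hut.memLp] with s h1 h2
    rw [integral_const_mul]
    congr 1
    unfold LQ.f
    have k1 := (h1.integrable one_le_two).const_mul Q.α0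
    have k2 : Integrable (fun _ : Ω => Q.α1 * ∫ ω', X s ω' ∂P) P := integrable_const _
    have k3 := (h2.integrable one_le_two).const_mul Q.β0
    have k4 := h2.integrable_sq.const_mul Q.γ0
    have k5 : Integrable (fun _ : Ω => Q.β1 * ∫ ω', u s ω' ∂P) P := integrable_const _
    have k6 : Integrable (fun _ : Ω => Q.γ1 * (∫ ω', u s ω' ∂P) ^ 2) P := integrable_const _
    rw [integral_sub (by exact ((((k1.sub k2).sub k3).sub k4).sub k5)) k6,
      integral_sub (by exact (((k1.sub k2).sub k3).sub k4)) k5,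
      integral_sub (by exact ((k1.sub k2).sub k3)) k4,
      integral_sub (by exact (k1.sub k2)) k3, integral_sub k1 k2]
    simp only [integral_const_mul, integral_const, probReal_univ, one_smul]
    ring
  · simp

/-- The reward depends on the control only through its mean and its second moment. -/
lemma Model.J_eq [P.IsComplete] (M : Model) (Q : LQ) {W : ℝ≥0 → Ω → ℝ} (hW : IsBrownianReal W P)
    {t : ℝ} (x : ℝ) (ht : t ∈ Icc 0 M.T) {u : ℝ → Ω → ℝ}
    (hu : u ∈ M.controls P (augFiltration W P hW)) :
    M.J Q.f Q.g P (augFiltration W P hW) W t x u =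
      M.baseReward Q t x + ∫ s in t..M.T, M.running Q P t u s := by
  have htT := ht.2
  have hX := M.isSolution_state hW x ht hu
  have hut := MemL2Prog.mono hu ht.1
  rw [Model.J, M.J_eq_of_isSolution Q hW ht hu hX]
  set X := M.state P (augFiltration W P hW) W t x u
  have iX := intervalIntegrable_mean htT hX.memL2
  have iF := intervalIntegrable_mean htT (M.memL2Prog_force ht hu)
  have hdual := M.duality Q htT iX iF (fun s hs => (hX.mean_eq hW ht hu hs).2)
  rw [M.integral_dcostate_force Q x ht hu] at hdual
  have hec : ContinuousOn (fun s => Real.exp (-M.r * (s - t))) (uIcc t M.T) := by fun_prop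
  have i1 : IntervalIntegrable (fun s => Real.exp (-M.r * (s - t)) *
      ((Q.α0 - Q.α1) * ∫ ω, X s ω ∂P)) volume t M.T :=
    (iX.const_mul (Q.α0 - Q.α1)).continuousOn_mul hec
  have i2 : IntervalIntegrable (fun s => Real.exp (-M.r * (s - t)) *
      ((Q.β0 + Q.β1) * (∫ ω, u s ω ∂P) + Q.γ0 * (∫ ω, u s ω ^ 2 ∂P) +
      Q.γ1 * (∫ ω, u s ω ∂P) ^ 2)) volume t M.T :=
    ((((intervalIntegrable_mean htT hut).const_mul _).add
      ((intervalIntegrable_mean_sq htT hut).const_mul _)).add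
      ((intervalIntegrable_sq_mean htT hut).const_mul _)).continuousOn_mul hec
  have hrun : ∫ s in t..M.T, Real.exp (-M.r * (s - t)) * (M.marginal Q s * ∫ ω, u s ω ∂P) =
      (∫ s in t..M.T, M.running Q P t u s) + ∫ s in t..M.T, Real.exp (-M.r * (s - t)) *
      ((Q.β0 + Q.β1) * (∫ ω, u s ω ∂P) + Q.γ0 * (∫ ω, u s ω ^ 2 ∂P) +
      Q.γ1 * (∫ ω, u s ω ∂P) ^ 2) := by
    rw [← intervalIntegral.integral_add (M.intervalIntegrable_running Q ht hu) i2]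
    congr 1; ext s; unfold Model.running; ring
  have hsplit : ∫ s in t..M.T, Real.exp (-M.r * (s - t)) * ((Q.α0 - Q.α1) * (∫ ω, X s ω ∂P) -
      (Q.β0 + Q.β1) * (∫ ω, u s ω ∂P) - Q.γ0 * (∫ ω, u s ω ^ 2 ∂P) -
      Q.γ1 * (∫ ω, u s ω ∂P) ^ 2) =
      (∫ s in t..M.T, Real.exp (-M.r * (s - t)) * ((Q.α0 - Q.α1) * ∫ ω, X s ω ∂P)) -
      ∫ s in t..M.T, Real.exp (-M.r * (s - t)) *
      ((Q.β0 + Q.β1) * (∫ ω, u s ω ∂P) + Q.γ0 * (∫ ω, u s ω ^ 2 ∂P) +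
      Q.γ1 * (∫ ω, u s ω ∂P) ^ 2) := by
    rw [← intervalIntegral.integral_sub i1 i2]
    congr 1; ext s; ring
  rw [hsplit]
  linear_combination hdual + hrun

/-- A deterministic control which agrees on `[0, T]` with the pointwise maximiser is optimal: by
Jensen's inequality the running reward of `u` is at most `(q - β) m - (γ₀ + γ₁) m²` with `m = 𝔼[u]`,
where `q` is the marginal value and `β = β₀ + β₁`; the maximum over `m` is the given control. -/
lemma Model.isOptimal_of_eq_marginal [P.IsComplete] (M : Model) (Q : LQ) {W : ℝ≥0 → Ω → ℝ}
    (hW : IsBrownianReal W P) {t : ℝ} (x : ℝ) (ht : t ∈ Icc 0 M.T) {v : ℝ → ℝ}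
    (hv : ∀ s ∈ Icc 0 M.T, v s = (M.marginal Q s - (Q.β0 + Q.β1)) / (2 * (Q.γ0 + Q.γ1))) :
    M.IsOptimal Q.f Q.g P (augFiltration W P hW) W t x (fun s _ => v s) := by
  have hΓ : 0 < Q.γ0 + Q.γ1 := add_pos Q.γ0_pos Q.γ1_pos
  have hvm : Measurable fun s => (M.marginal Q s - (Q.β0 + Q.β1)) / (2 * (Q.γ0 + Q.γ1)) :=
    ((M.measurable_marginal Q).sub_const _).div_const _
  have hvc : (fun s _ => v s) ∈ M.controls P (augFiltration W P hW) := by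
    refine ⟨.of_measurable ?_, ?_⟩
    · convert hvm.comp (measurable_subtype_coe (p := (· ∈ Icc 0 M.T))) using 1
      ext s
      exact hv s s.2
    · obtain ⟨C, hC⟩ := M.exists_marginal_bound Q
      have : MemLp v 2 (volume.restrict (Icc 0 M.T)) := by
        refine MemLp.of_bound (hvm.aestronglyMeasurable.congr ?_)
          ((C + ‖Q.β0 + Q.β1‖) / ‖2 * (Q.γ0 + Q.γ1)‖) ?_
        · filter_upwards [ae_restrict_mem measurableSet_Icc] with s hs using (hv s hs).symm
        · filter_upwards [ae_restrict_mem measurableSet_Icc] with s hs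
          rw [hv s hs, norm_div]
          gcongr
          exact (norm_sub_le _ _).trans (by gcongr; exact hC s hs)
      exact this.comp_fst P
  refine ⟨hvc, le_antisymm (iSup₂_le fun u hu => ?_)
    (le_iSup₂ (f := fun u (_ : u ∈ M.controls P (augFiltration W P hW)) =>
      (M.J Q.f Q.g P (augFiltration W P hW) W t x u : EReal)) _ hvc)⟩
  rw [EReal.coe_le_coe_iff, M.J_eq Q hW x ht hu, M.J_eq Q hW x ht hvc]
  refine add_le_add_right (intervalIntegral.integral_mono_ae_restrict ht.2
    (M.intervalIntegrable_running Q ht hu) (M.intervalIntegrable_running Q ht hvc) ?_) _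
  filter_upwards [sq_mean_le (MemL2Prog.mono hu ht.1).memLp,
    ae_restrict_mem measurableSet_Icc] with s hs hst
  have hvs := hv s ⟨ht.1.trans hst.1, hst.2⟩
  rw [eq_div_iff (by positivity)] at hvs
  unfold Model.running
  refine mul_le_mul_of_nonneg_left ?_ (Real.exp_nonneg _)
  simp only [integral_const, probReal_univ, one_smul]
  have h1 := mul_le_mul_of_nonneg_left hs Q.γ0_pos.le
  -- completing the square: the difference is `(γ₀ + γ₁) (𝔼[u(s)] - v(s))²`
  have h2 := mul_nonneg hΓ.le (sq_nonneg ((∫ ω, u s ω ∂P) - v s))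
  rw [← hvs]
  nlinarith

end Stochastic

/-! ### The marginal value as `⟨B* a(s), (1,1)⟩` -/

/-- Dominated convergence in `L²` of a finite measure. -/
lemma tendsto_toLp_of_bounded {α ι E : Type*} [MeasurableSpace α] {μ : Measure α}
    [IsFiniteMeasure μ] [NormedAddCommGroup E] {l : Filter ι} [l.IsCountablyGenerated]
    {f : ι → α → E} {g : α → E} (hf : ∀ n, MemLp (f n) 2 μ) (hg : MemLp g 2 μ) {C : ℝ}
    (hC : ∀ᶠ n in l, ∀ᵐ x ∂μ, ‖f n x - g x‖ ≤ C)
    (hlim : ∀ᵐ x ∂μ, Filter.Tendsto (fun n => f n x) l (nhds (g x))) :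
    Filter.Tendsto (fun n => (hf n).toLp (f n)) l (nhds (hg.toLp g)) := by
  rw [Lp.tendsto_Lp_iff_tendsto_eLpNorm'']
  simp only [eLpNorm_eq_lintegral_rpow_enorm_toReal two_ne_zero ENNReal.ofNat_ne_top,
    ENNReal.toReal_ofNat, Pi.sub_apply, ENNReal.rpow_ofNat]
  have h : Filter.Tendsto (fun n => ∫⁻ x, ‖f n x - g x‖ₑ ^ 2 ∂μ) l (nhds (∫⁻ _, 0 ∂μ)) := by
    refine tendsto_lintegral_filter_of_dominated_convergence' (fun _ => ENNReal.ofReal C ^ 2)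
      (Filter.Eventually.of_forall fun n =>
        (((hf n).aestronglyMeasurable.sub hg.aestronglyMeasurable).enorm.pow_const 2)) ?_ ?_ ?_
    · filter_upwards [hC] with n hn
      filter_upwards [hn] with x hx
      gcongr
      rw [← ofReal_norm]
      exact ENNReal.ofReal_le_ofReal hx
    · simp [lintegral_const, ENNReal.mul_eq_top]
    · filter_upwards [hlim] with x hx
      have h1 := (hx.sub_const (g x)).enorm
      rw [sub_self, enorm_zero] at h1
      have h2 := ((ENNReal.continuous_pow 2).tendsto 0).comp h1
      simpa [Function.comp_def] using h2
  rw [lintegral_zero] at h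
  have h2 := ((ENNReal.continuous_rpow_const (y := 1 / 2)).tendsto 0).comp h
  simpa [Function.comp_def] using h2

/-- The vector `(1,1)`. -/
def ones : E2 := !₂[1, 1]

lemma Model.A0_ones (M : Model) : M.A0 ones = (M.a0 + M.a1) • ones := by
  ext i
  fin_cases i <;> simp [Model.A0, ones]

/-- `(1,1)` is an eigenvector of `A₀`, so that pairing with it scalarises `e^{τ A₀*}`. -/
lemma Model.inner_expA0star_ones (M : Model) (τ : ℝ) (w : E2) :
    ⟪M.expA0star τ w, ones⟫_ℝ = Real.exp ((M.a0 + M.a1) * τ) * ⟪w, ones⟫_ℝ := by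
  set c := M.a0 + M.a1 with hc
  have hd : ∀ τ, HasDerivAt (fun τ => ⟪M.expA0star τ w, ones⟫_ℝ)
      (c * ⟪M.expA0star τ w, ones⟫_ℝ) τ := fun τ => by
    have h1 : HasDerivAt M.expA0star (ContinuousLinearMap.adjoint M.A0 * M.expA0star τ) τ :=
      hasDerivAt_exp_smul_const' (𝕂 := ℝ) (ContinuousLinearMap.adjoint M.A0) τ
    have h2 := (h1.clm_apply (hasDerivAt_const τ w)).inner ℝ (hasDerivAt_const τ ones)
    refine h2.congr_deriv ?_
    rw [inner_zero_right, zero_add, map_zero, add_zero, mul_apply_eq_comp,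
      ContinuousLinearMap.adjoint_inner_left, M.A0_ones, inner_smul_right]
  have hd2 : ∀ τ, HasDerivAt (fun τ => Real.exp (-(c * τ)) * ⟪M.expA0star τ w, ones⟫_ℝ) 0 τ :=
    fun τ => by
      have h1 : HasDerivAt (fun s => Real.exp (-(c * s))) (Real.exp (-(c * τ)) * -(c * 1)) τ :=
        ((hasDerivAt_id τ).const_mul c).neg.exp
      refine (h1.mul (hd τ)).congr_deriv ?_
      ring
  have h := is_const_of_deriv_eq_zero (fun τ => (hd2 τ).differentiableAt)
    (fun τ => (hd2 τ).deriv) τ 0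
  have h0 : M.expA0star 0 = 1 := by simp [Model.expA0star, NormedSpace.exp_zero]
  simp only [h0, mul_zero, neg_zero, Real.exp_zero, one_mul, one_apply_eq_self] at h
  rw [← h, ← mul_assoc, ← Real.exp_add]
  simp

/-- The history component of `e^{τ A*} (w, 0)`. -/
def Model.histFun (M : Model) (w : E2) (τ ξ : ℝ) : E2 :=
  (Ioi (-τ)).indicator (fun ξ => M.expA0star (ξ + τ) w) ξ

lemma Model.semigroupHist_ae_eq (M : Model) (w : E2) (τ : ℝ) :
    M.semigroupHist τ (WithLp.toLp 2 (w, 0)) =ᵐ[M.hist] M.histFun w τ := by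
  have h0 : ∀ᵐ ξ, ξ ∈ Icc (-M.d) 0 → ((0 : Lp E2 2 M.hist) : ℝ → E2) ξ = 0 :=
    (ae_restrict_iff' measurableSet_Icc).1 (Lp.coeFn_zero E2 2 M.hist)
  have h1 := (measurePreserving_add_right volume τ).quasiMeasurePreserving.ae h0
  filter_upwards [ae_restrict_of_ae h1] with ξ hξ
  unfold Model.semigroupHist Model.histFun
  by_cases h : -τ < ξ
  · rw [indicator_of_mem (mem_Ioi.2 h), piecewise_eq_of_mem _ _ _ (by exact h)]
    rfl
  · rw [indicator_of_notMem (by simpa using h), piecewise_eq_of_notMem _ _ _ (by exact h)]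
    by_cases h2 : ξ + τ ∈ Icc (-M.d) 0
    · rw [indicator_of_mem h2]; exact hξ h2
    · rw [indicator_of_notMem h2]

lemma Model.memLp_histFun (M : Model) (w : E2) (τ : ℝ) : MemLp (M.histFun w τ) 2 M.hist :=
  (memLp_congr_ae (M.semigroupHist_ae_eq w τ)).1 (M.memLp_semigroupHist τ _)

lemma Model.semigroup_eq (M : Model) (w : E2) (τ : ℝ) :
    M.semigroup τ (WithLp.toLp 2 (w, 0)) =
      WithLp.toLp 2 (M.expA0star τ w, (M.memLp_histFun w τ).toLp _) := by
  unfold Model.semigroup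
  congr 2
  exact MemLp.toLp_congr _ _ (M.semigroupHist_ae_eq w τ)

/-- Strong continuity of the semigroup on vectors without history. -/
lemma Model.continuous_semigroup (M : Model) (w : E2) :
    Continuous fun τ => M.semigroup τ (WithLp.toLp 2 (w, 0)) := by
  simp only [M.semigroup_eq]
  have hcw : Continuous fun τ => M.expA0star τ w :=
    M.continuous_expA0star.clm_apply continuous_const
  refine (WithLp.prod_continuous_toLp 2 E2 (Lp E2 2 M.hist)).comp (hcw.prodMk ?_)
  refine continuous_iff_continuousAt.2 fun τ₀ => ?_
  obtain ⟨C, hC⟩ := isCompact_Icc.exists_bound_of_continuousOn hcw.continuousOn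
    (s := Icc (-M.d + τ₀ - 1) (τ₀ + 1))
  have hd := M.d_nonneg
  have hC0 : 0 ≤ C := (norm_nonneg _).trans (hC τ₀ ⟨by linarith, by linarith⟩)
  have hb : ∀ τ ∈ Icc (τ₀ - 1) (τ₀ + 1), ∀ ξ ∈ Icc (-M.d) 0, ‖M.histFun w τ ξ‖ ≤ C :=
    fun τ hτ ξ hξ => by
      unfold Model.histFun
      refine (norm_indicator_le_norm_self _ _).trans
        (hC _ ⟨by linarith [hτ.1, hξ.1], by linarith [hτ.2, hξ.2]⟩)
  refine tendsto_toLp_of_bounded (M.memLp_histFun w) (M.memLp_histFun w τ₀) (C := C + C) ?_ ?_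
  · filter_upwards [Icc_mem_nhds (by linarith : τ₀ - 1 < τ₀) (by linarith : τ₀ < τ₀ + 1)] with τ hτ
    filter_upwards [ae_restrict_mem measurableSet_Icc] with ξ hξ
    exact (norm_sub_le _ _).trans
      (add_le_add (hb τ hτ ξ hξ) (hb τ₀ ⟨by linarith, by linarith⟩ ξ hξ))
  · have hne : ∀ᵐ ξ ∂M.hist, ξ ≠ -τ₀ := ae_restrict_of_ae (by simp [ae_iff])
    filter_upwards [hne] with ξ hξ
    rcases lt_or_gt_of_ne hξ with h | h
    · have hev : ∀ᶠ τ in nhds τ₀, M.histFun w τ ξ = M.histFun w τ₀ ξ := by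
        filter_upwards [Iio_mem_nhds (by linarith : τ₀ < -ξ)] with τ hτ
        rw [mem_Iio] at hτ
        unfold Model.histFun
        rw [indicator_of_notMem (by simp; linarith), indicator_of_notMem (by simp; linarith)]
      exact tendsto_const_nhds.congr' (hev.mono fun _ h => h.symm)
    · have hev : ∀ᶠ τ in nhds τ₀, M.histFun w τ ξ = M.expA0star (ξ + τ) w := by
        filter_upwards [Ioi_mem_nhds (by linarith : -ξ < τ₀)] with τ hτ
        rw [mem_Ioi] at hτ
        unfold Model.histFun
        rw [indicator_of_mem (by simp; linarith)]
      have h0 : M.histFun w τ₀ ξ = M.expA0star (ξ + τ₀) w := hev.self_of_nhds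
      rw [h0]
      refine Filter.Tendsto.congr' (hev.mono fun _ h => h.symm) ?_
      exact (hcw.comp (continuous_const.add continuous_id)).tendsto τ₀

/-- The scalar kernel `1_{ξ > -τ} e^{(a₀ + a₁)(ξ + τ)}`. -/
def Model.expKernel (M : Model) (τ ξ : ℝ) : ℝ :=
  (Ioi (-τ)).indicator (fun ξ => Real.exp ((M.a0 + M.a1) * (ξ + τ))) ξ

lemma Model.inner_semigroup_B_ones (M : Model) (w : E2) (τ : ℝ) :
    ⟪M.semigroup τ (WithLp.toLp 2 (w, 0)), M.B ones⟫_ℝ = ⟪w, ones⟫_ℝ *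
      (M.b0 * Real.exp ((M.a0 + M.a1) * τ) + ∫ ξ, M.kern ξ * M.expKernel τ ξ) := by
  rw [M.semigroup_eq]
  have hB : M.B ones = WithLp.toLp 2 (M.b0 • ones, (M.memLp_b1_smul ones).toLp _) := rfl
  rw [hB, WithLp.prod_inner_apply]
  simp only
  rw [inner_smul_right, M.inner_expA0star_ones, L2.inner_def, mul_add]
  congr 1
  · ring
  · rw [← integral_const_mul, ← setIntegral_eq_integral_of_forall_compl_eq_zero
      (s := Icc (-M.d) 0) (f := fun ξ => ⟪w, ones⟫_ℝ * (M.kern ξ * M.expKernel τ ξ))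
      (fun ξ hξ => by rw [M.kern_spec.2.2.2.1 ξ hξ]; ring)]
    refine integral_congr_ae ?_
    filter_upwards [(M.memLp_histFun w τ).coeFn_toLp, (M.memLp_b1_smul ones).coeFn_toLp,
      (ae_restrict_iff' measurableSet_Icc).2 M.kern_spec.2.2.2.2] with ξ h1 h2 h3
    rw [h1, h2, inner_smul_right, h3]
    unfold Model.histFun Model.expKernel
    by_cases h : ξ ∈ Ioi (-τ)
    · rw [indicator_of_mem h, indicator_of_mem h, M.inner_expA0star_ones]; ring
    · rw [indicator_of_notMem h, indicator_of_notMem h, inner_zero_left]; ring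

lemma Model.costate_eq (M : Model) (Q : LQ) (s : ℝ) :
    M.costate Q s = (Q.lam0 - Q.lam1) * Real.exp ((M.a0 + M.a1 - M.r) * (M.T - s)) +
      (Q.α0 - Q.α1) * ∫ ρ in s..M.T, Real.exp ((M.a0 + M.a1 - M.r) * (ρ - s)) := by
  unfold Model.costate
  set κ := M.a0 + M.a1 - M.r
  have h : ∀ ρ, Real.exp (κ * (ρ - s)) = Real.exp (-(κ * s)) * Real.exp (κ * ρ) := fun ρ => by
    rw [← Real.exp_add]; congr 1; ring
  simp only [h, intervalIntegral.integral_const_mul]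
  ring

/-- The weight `e^{rξ} A(s - ξ) 1_{s - ξ ≤ T}` of `b₁(ξ)` in the marginal value, resolved along the
representation of the costate. At `ξ = s - T` the two sides may differ, as `expKernel` is cut off by a
strict inequality. -/
lemma Model.kern_mul_costate (M : Model) (Q : LQ) {s ξ : ℝ} (hs : s ∈ Icc 0 M.T)
    (hξ : ξ ∈ Icc (-M.d) 0) (hne : ξ ≠ s - M.T) :
    Real.exp (M.r * ξ) * (Icc 0 M.T).indicator (M.costate Q) (s - ξ) =
      (Q.lam0 - Q.lam1) * (Real.exp (-M.r * (M.T - s)) * M.expKernel (M.T - s) ξ) +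
      (Q.α0 - Q.α1) * ∫ ρ in s..M.T, Real.exp (-M.r * (ρ - s)) * M.expKernel (ρ - s) ξ := by
  have hexp : ∀ ρ, Real.exp (-M.r * (ρ - s)) * Real.exp ((M.a0 + M.a1) * (ξ + (ρ - s))) =
      Real.exp (M.r * ξ) * Real.exp ((M.a0 + M.a1 - M.r) * (ρ - (s - ξ))) := fun ρ => by
    rw [← Real.exp_add, ← Real.exp_add]; congr 1; ring
  by_cases h : s - ξ < M.T
  · rw [indicator_of_mem (mem_Icc.2 ⟨by linarith [hs.1, hξ.2], h.le⟩), M.costate_eq, mul_add]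
    congr 1
    · unfold Model.expKernel
      rw [indicator_of_mem (by simp; linarith), hexp]
      ring
    · rw [mul_left_comm]
      congr 1
      rw [intervalIntegral.integral_of_le hs.2, intervalIntegral.integral_of_le h.le,
        ← integral_const_mul, ← integral_indicator measurableSet_Ioc,
        ← integral_indicator measurableSet_Ioc]
      congr 1
      ext ρ
      by_cases h1 : ρ ∈ Ioc (s - ξ) M.T
      · rw [indicator_of_mem h1, indicator_of_mem (mem_Ioc.2 ⟨by linarith [h1.1, hξ.2], h1.2⟩),
          Model.expKernel, indicator_of_mem (by simp; linarith [h1.1]), hexp]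
      · rw [indicator_of_notMem h1]
        by_cases h2 : ρ ∈ Ioc s M.T
        · have h3 : ρ ≤ s - ξ := not_lt.1 fun h' => h1 ⟨h', h2.2⟩
          rw [indicator_of_mem h2, Model.expKernel, indicator_of_notMem (by simp; linarith),
            mul_zero]
        · rw [indicator_of_notMem h2]
  · have h' : M.T < s - ξ := lt_of_le_of_ne (not_lt.1 h) fun e => hne (by linarith)
    rw [indicator_of_notMem (fun h2 => absurd h2.2 (not_le.2 h')), Model.expKernel,
      indicator_of_notMem (by simp; linarith),
      intervalIntegral.integral_congr (g := fun _ => (0 : ℝ)) fun ρ hρ => ?_]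
    · simp
    · rw [uIcc_of_le hs.2] at hρ
      simp only
      rw [Model.expKernel, indicator_of_notMem (by simp; linarith [hρ.2]), mul_zero]

lemma Model.integrable_kern_mul_expKernel (M : Model) (τ : ℝ) :
    Integrable fun ξ => M.kern ξ * M.expKernel τ ξ := by
  obtain ⟨C, hC⟩ := isCompact_Icc.exists_bound_of_continuousOn (s := Icc (-M.d) 0)
    (by fun_prop : Continuous fun ξ => Real.exp ((M.a0 + M.a1) * (ξ + τ))).continuousOn
  have hm : Measurable (M.expKernel τ) := Measurable.indicator (by fun_prop) measurableSet_Ioi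
  refine (M.kern_spec.2.2.1.norm.mul_const C).mono'
    (M.kern_spec.1.mul hm).aestronglyMeasurable (ae_of_all _ fun ξ => ?_)
  rw [norm_mul]
  by_cases hξ : ξ ∈ Icc (-M.d) 0
  · exact mul_le_mul_of_nonneg_left ((norm_indicator_le_norm_self _ _).trans (hC ξ hξ))
      (norm_nonneg _)
  · simp [M.kern_spec.2.2.2.1 ξ hξ]

lemma Model.integrable_kern_expKernel (M : Model) (s : ℝ) :
    Integrable (Function.uncurry fun ρ ξ =>
      M.kern ξ * (Real.exp (-M.r * (ρ - s)) * M.expKernel (ρ - s) ξ))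
      ((volume.restrict (Ioc s M.T)).prod volume) := by
  obtain ⟨C, hC⟩ := ((isCompact_Icc (a := s) (b := M.T)).prod
    (isCompact_Icc (a := -M.d) (b := 0))).exists_bound_of_continuousOn
    (f := fun q : ℝ × ℝ => Real.exp (-M.r * (q.1 - s)) *
      Real.exp ((M.a0 + M.a1) * (q.2 + (q.1 - s)))) (by fun_prop)
  have hm : Measurable fun q : ℝ × ℝ => M.expKernel (q.1 - s) q.2 := by
    have : (fun q : ℝ × ℝ => M.expKernel (q.1 - s) q.2) =
        {q : ℝ × ℝ | -(q.1 - s) < q.2}.indicator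
          fun q => Real.exp ((M.a0 + M.a1) * (q.2 + (q.1 - s))) := by
      ext q; simp [Model.expKernel, indicator]
    rw [this]
    exact Measurable.indicator (by fun_prop) (measurableSet_lt (by fun_prop) measurable_snd)
  refine ((M.kern_spec.2.2.1.norm.mul_const C).comp_snd _).mono'
    (Measurable.aestronglyMeasurable ?_) ?_
  · exact (M.kern_spec.1.comp measurable_snd).mul (Measurable.mul (by fun_prop) hm)
  · have h3 : ∀ᵐ q ∂((volume.restrict (Ioc s M.T)).prod (volume : Measure ℝ)), q.1 ∈ Ioc s M.T :=
      Measure.quasiMeasurePreserving_fst.ae (ae_restrict_mem measurableSet_Ioc)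
    filter_upwards [h3] with q hq
    simp only [Function.uncurry]
    rw [norm_mul]
    by_cases hξ : q.2 ∈ Icc (-M.d) 0
    · refine mul_le_mul_of_nonneg_left (le_trans ?_ (hC q ⟨⟨hq.1.le, hq.2⟩, hξ⟩)) (norm_nonneg _)
      rw [norm_mul, norm_mul]
      exact mul_le_mul_of_nonneg_left (norm_indicator_le_norm_self _ _) (norm_nonneg _)
    · simp [M.kern_spec.2.2.2.1 _ hξ]

/-- The pairing of `B* a(s)` with `(1,1)` is the scalar marginal value of the control. -/
lemma Model.inner_Bstar_a (M : Model) (Q : LQ) {s : ℝ} (hs : s ∈ Icc 0 M.T) :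
    ⟪M.Bstar (M.a Q s), ones⟫_ℝ = M.marginal Q s := by
  have hlam : ⟪Q.lamt, ones⟫_ℝ = Q.lam0 - Q.lam1 := by
    simp [LQ.lamt, ones, PiLp.inner_apply, sub_eq_add_neg]
  have hal : ⟪Q.αt, ones⟫_ℝ = Q.α0 - Q.α1 := by
    simp [LQ.αt, ones, PiLp.inner_apply, sub_eq_add_neg]
  have hcont : Continuous fun ρ => Real.exp (-M.r * (ρ - s)) •
      M.semigroup (ρ - s) (WithLp.toLp 2 (Q.αt, 0)) :=
    (by fun_prop : Continuous fun ρ => Real.exp (-M.r * (ρ - s))).smul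
      ((M.continuous_semigroup Q.αt).comp (continuous_id.sub continuous_const))
  have hint := hcont.intervalIntegrable (μ := volume) s M.T
  have hswap := M.integrable_kern_expKernel s
  have hI : ⟪∫ ρ in s..M.T, Real.exp (-M.r * (ρ - s)) •
      M.semigroup (ρ - s) (WithLp.toLp 2 (Q.αt, 0)), M.B ones⟫_ℝ =
      (Q.α0 - Q.α1) * (M.b0 * (∫ ρ in s..M.T, Real.exp ((M.a0 + M.a1 - M.r) * (ρ - s))) +
        ∫ ξ, M.kern ξ * ∫ ρ in s..M.T, Real.exp (-M.r * (ρ - s)) * M.expKernel (ρ - s) ξ) := by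
    have e1 : ∀ ξ, M.kern ξ * ∫ ρ in s..M.T, Real.exp (-M.r * (ρ - s)) * M.expKernel (ρ - s) ξ =
        ∫ ρ in Ioc s M.T, M.kern ξ * (Real.exp (-M.r * (ρ - s)) * M.expKernel (ρ - s) ξ) :=
      fun ξ => by rw [intervalIntegral.integral_of_le hs.2, integral_const_mul]
    simp only [e1]
    rw [← integral_integral_swap hswap, real_inner_comm, intervalIntegral.integral_of_le hs.2,
      intervalIntegral.integral_of_le hs.2, ← integral_inner hint.1, ← integral_const_mul M.b0,
      ← integral_add ?_ ?_, ← integral_const_mul]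
    · congr 1
      ext ρ
      rw [inner_smul_right, real_inner_comm, M.inner_semigroup_B_ones, hal]
      have h1 : Real.exp ((M.a0 + M.a1 - M.r) * (ρ - s)) =
          Real.exp (-M.r * (ρ - s)) * Real.exp ((M.a0 + M.a1) * (ρ - s)) := by
        rw [← Real.exp_add]; congr 1; ring
      have h2 : ∫ ξ, M.kern ξ * (Real.exp (-M.r * (ρ - s)) * M.expKernel (ρ - s) ξ) =
          Real.exp (-M.r * (ρ - s)) * ∫ ξ, M.kern ξ * M.expKernel (ρ - s) ξ := by
        rw [← integral_const_mul]; congr 1; ext ξ; ring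
      rw [h1, h2]
      ring
    · have hc : Continuous fun ρ => Real.exp ((M.a0 + M.a1 - M.r) * (ρ - s)) := by fun_prop
      exact Integrable.const_mul hc.integrableOn_Ioc M.b0
    · exact hswap.integral_prod_left
  have hK : ∫ ξ, M.kern ξ * (Real.exp (M.r * ξ) * (Icc 0 M.T).indicator (M.costate Q) (s - ξ)) =
      (Q.lam0 - Q.lam1) * (Real.exp (-M.r * (M.T - s)) * ∫ ξ, M.kern ξ * M.expKernel (M.T - s) ξ) +
      (Q.α0 - Q.α1) * ∫ ξ, M.kern ξ * ∫ ρ in s..M.T,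
        Real.exp (-M.r * (ρ - s)) * M.expKernel (ρ - s) ξ := by
    rw [← integral_const_mul, ← integral_const_mul, ← integral_const_mul, ← integral_add ?_ ?_]
    · refine integral_congr_ae ?_
      have hne : ∀ᵐ ξ : ℝ, ξ ≠ s - M.T := by simp [ae_iff]
      filter_upwards [hne] with ξ hξ
      by_cases h : ξ ∈ Icc (-M.d) 0
      · rw [M.kern_mul_costate Q hs h hξ]; ring
      · simp [M.kern_spec.2.2.2.1 ξ h]
    · refine (((M.integrable_kern_mul_expKernel (M.T - s)).const_mul
        (Real.exp (-M.r * (M.T - s)))).const_mul (Q.lam0 - Q.lam1))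
    · have := hswap.integral_prod_right.const_mul (Q.α0 - Q.α1)
      refine this.congr (ae_of_all _ fun ξ => ?_)
      simp only [Function.uncurry]
      rw [intervalIntegral.integral_of_le hs.2, integral_const_mul]
  rw [Model.Bstar, ContinuousLinearMap.adjoint_inner_left, Model.a, inner_add_left,
    real_inner_smul_left, M.inner_semigroup_B_ones, hlam, hI, Model.marginal, hK, M.costate_eq]
  have h1 : Real.exp ((M.a0 + M.a1 - M.r) * (M.T - s)) =
      Real.exp (-M.r * (M.T - s)) * Real.exp ((M.a0 + M.a1) * (M.T - s)) := by
    rw [← Real.exp_add]; congr 1; ring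
  rw [h1]
  ring

/-- The maximum of a concave quadratic is at its vertex. -/
lemma LQ.eq_of_isMaxOn_hamiltonian (Q : LQ) {y q : E2} {v : ℝ}
    (hv : IsMaxOn (Q.hamiltonian y q) univ v) :
    v = ⟪q - Q.βt, !₂[1, 1]⟫_ℝ / (2 * (Q.γ0 + Q.γ1)) := by
  have hΓ : 0 < Q.γ0 + Q.γ1 := add_pos Q.γ0_pos Q.γ1_pos
  set b := ⟪q - Q.βt, !₂[1, 1]⟫_ℝ with hb
  set w := b / (2 * (Q.γ0 + Q.γ1)) with hw
  have h := hv (mem_univ w)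
  simp only [mem_ofPred_eq, LQ.hamiltonian, ← hb] at h
  have hbw : w * (2 * (Q.γ0 + Q.γ1)) = b := by rw [hw]; field_simp
  rw [← hbw] at h
  have h2 : (Q.γ0 + Q.γ1) * (v - w) ^ 2 ≤ 0 := by nlinarith
  have h3 : (v - w) ^ 2 = 0 :=
    le_antisymm (by by_contra h'; exact absurd h2 (not_le.2 (mul_pos hΓ (not_le.1 h'))))
      (sq_nonneg _)
  exact sub_eq_zero.1 (pow_eq_zero_iff two_ne_zero |>.1 h3)

end Advertising

end

open Advertising in
theorem mainTheorem2 {Ω : Type*} {mΩ : MeasurableSpace Ω} (P : Measure Ω)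
    [IsProbabilityMeasure P] [P.IsComplete]
    (W : ℝ≥0 → Ω → ℝ) (hW : IsBrownianReal W P)
    (M : Model) (Q : LQ) (t x : ℝ) (ht : t ∈ Icc 0 M.T)
    (uStar : E2 → ℝ)
    (huStar : ∀ q : E2, IsMaxOn (Q.hamiltonian !₂[x, x] q) univ (uStar q)) :
    -- the maximiser is explicit
    (∀ q : E2, uStar q = ⟪q - Q.βt, !₂[1, 1]⟫_ℝ / (2 * (Q.γ0 + Q.γ1))) ∧
    -- the state equation is well posed for every admissible control
    (∀ u ∈ M.controls P (augFiltration W P hW),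
      M.IsSolution P (augFiltration W P hW) W t x u (M.state P (augFiltration W P hW) W t x u) ∧
      ∀ X, M.IsSolution P (augFiltration W P hW) W t x u X →
        ∀ᵐ ω ∂P, ∀ s ∈ Icc t M.T, X s ω = M.state P (augFiltration W P hW) W t x u s ω) ∧
    -- the deterministic control `s ↦ u*(B* a(s))` is optimal
    M.IsOptimal Q.f Q.g P (augFiltration W P hW) W t x
      (fun s _ => uStar (M.Bstar (M.a Q s))) := by
  have hmax := fun q => Q.eq_of_isMaxOn_hamiltonian (huStar q)
  refine ⟨hmax, fun u hu => ?_, ?_⟩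
  · have h := M.isSolution_state hW x ht hu
    exact ⟨h, fun X hX => hX.unique hW ht hu h⟩
  · refine M.isOptimal_of_eq_marginal Q hW x ht (v := fun s => uStar (M.Bstar (M.a Q s)))
      fun s hs => ?_
    have hβ : ⟪Q.βt, ones⟫_ℝ = Q.β0 + Q.β1 := by simp [LQ.βt, ones, PiLp.inner_apply]
    rw [hmax, ← M.inner_Bstar_a Q hs, ← hβ, ← inner_sub_left]
    rfl
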